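/- Let $\kappa>0$, $\alpha\in[0,1]$, $\beta\in(0,1)$ with $\alpha<\beta$. Let $p,n,N\to\infty$ along a sequence with $p/N\to\alpha$ and $n/N\to\beta$. Let $X$ be a random $n\times N$ matrix whose rows are i.i.d. $\mathcal N(0,\Sigma)$, where $\Sigma=\operatorname{diag}(\lambda_1,\dots,\lambda_N)$ and $\lambda_j=j^{-\kappa}$. Let $\theta\in\mathbb R^N$ be drawn independently of $X$ from any distribution with $\mathbb E[\theta]=0$ and $\mathbb E[\theta\theta^{\top}]=I$, and let the responses be noiseless, $y=X\theta$. Write $X_P$ for the first $p$ columns of $X$. Let the estimator $\hat\theta\in\mathbb R^N$ have first $p$ entries $\hat\theta_P=(X_P^{\top}X_P)^{-1}X_P^{\top}y$ if $p\le n$ and $\hat\theta_P=X_P^{\top}(X_PX_P^{\top})^{-1}y$ if $p>n$, and all other entries $0$. Let $\operatorname{Error}=\mathbb E_{x}\big[(x^{\top}\theta-x^{\top}\hat\theta)^2\big]$, where $x\sim\mathcal N(0,\Sigma)$ is independent of $(X,\theta)$, and let $\mathbb E_\theta[\operatorname{Error}]$ be its average over $\theta$ for given $X$. For $a\in[0,\beta)$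 let $$\mathcal R_\kappa(a)=N^{1-\kappa}\int_a^1t^{-\kappa}\,dt\cdot\frac{\beta}{\beta-a}\in(0,\infty],$$ which is infinite exactly when $a=0$ and $\kappa\ge1$, and for $a\in(0,\beta)$ let $$h_\kappa(a)=\frac{\beta}{a}-\int_a^1t^{\kappa-2}\,dt-1.$$ 1. If $\alpha>0$ or $\kappa<1$, then $\mathbb E_\theta[\operatorname{Error}]=\mathcal R_\kappa(\alpha)\,(1+o_{\mathrm p}(1))$, that is, $\mathbb E_\theta[\operatorname{Error}]/\mathcal R_\kappa(\alpha)\to1$ in probability. In the remaining case $\alpha=0$, $\kappa\ge1$, in which $\mathcal R_\kappa(0)=\infty$, we have $N^{\kappa-1}\,\mathbb E_\theta[\operatorname{Error}]\to\infty$ in probability. 2. The equation $h_\kappa(a)=0$ has a unique solution $\alpha^*$ in $(0,\beta)$. For every $N\ge1$, the function $\mathcal R_\kappa$ is strictly decreasing on $[0,\alpha^*)$ and strictly increasing on $(\alpha^*,\beta)$, and $$\mathcal R_\kappa(\alpha^*)=\min_{0\le a<\beta}\mathcal R_\kappa(a)=N^{1-\kappa}\frac{\beta}{(\alpha^*)^{\kappa}}.$$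 -/

import Mathlib

open MeasureTheory ProbabilityTheory Filter Topology Matrix
open scoped ENNReal NNReal

namespace PCR

noncomputable section

/-- The `j`-th eigenvalue (`j` is counted from `0`) under polynomial decay: `(j + 1) ^ (-κ)`. -/
def eigenvalue (κ : ℝ) (j : ℕ) : ℝ := ((j : ℝ) + 1) ^ (-κ)

/-- The law `N(0, Σ)` on `ℝ^N` of a feature vector, with `Σ = diag(1 ^ (-κ), …, N ^ (-κ))`:
independent centred Gaussian coordinates whose variances are the eigenvalues. -/
def featureLaw (κ : ℝ) (N : ℕ) : Measure (Fin N → ℝ) :=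
  Measure.pi fun j => gaussianReal 0 (eigenvalue κ j).toNNReal

/-- The law of the `n × N` design matrix, whose rows are i.i.d. feature vectors. -/
def designLaw (κ : ℝ) (n N : ℕ) : Measure (Fin n → Fin N → ℝ) :=
  Measure.pi fun _ => featureLaw κ N

/-- The submatrix of the first `p` columns. -/
def firstCols {n N : ℕ} (p : ℕ) (X : Matrix (Fin n) (Fin N) ℝ) :
    Matrix (Fin n) {j : Fin N // (j : ℕ) < p} ℝ :=
  X.submatrix id Subtype.val

/-- The selected part of the estimator: least squares if `p ≤ n`, and the least norm
interpolating solution if `p > n`. -/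
def selectedCoef {n N : ℕ} (p : ℕ) (X : Matrix (Fin n) (Fin N) ℝ) (y : Fin n → ℝ) :
    {j : Fin N // (j : ℕ) < p} → ℝ :=
  if p ≤ n then
    (((firstCols p X)ᵀ * firstCols p X)⁻¹ * (firstCols p X)ᵀ) *ᵥ y
  else
    ((firstCols p X)ᵀ * (firstCols p X * (firstCols p X)ᵀ)⁻¹) *ᵥ y

/-- The principal component regression estimator: zero on the coordinates not selected. -/
def estimator {n N : ℕ} (p : ℕ) (X : Matrix (Fin n) (Fin N) ℝ) (y : Fin n → ℝ) : Fin N → ℝ :=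
  fun j => if h : (j : ℕ) < p then selectedCoef p X y ⟨j, h⟩ else 0

/-- The prediction error `E_{x,y} (y - xᵀ θ')²` in the noiseless model `y = xᵀ θ`, where `θ'` is
the estimator fitted to the design `X` and to the noiseless responses `X θ`. -/
def predictionError (κ : ℝ) {n N : ℕ} (p : ℕ) (X : Matrix (Fin n) (Fin N) ℝ)
    (θ : Fin N → ℝ) : ℝ :=
  ∫ x, (x ⬝ᵥ θ - x ⬝ᵥ estimator p X (X *ᵥ θ)) ^ 2 ∂(featureLaw κ N)

/-- An isotropic prior on `ℝ^N`: a probability law with mean `0` and second moment matrix `I`. -/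
structure IsIsotropic {N : ℕ} (π : Measure (Fin N → ℝ)) : Prop where
  isProbabilityMeasure : IsProbabilityMeasure π
  integrable_coord : ∀ i, Integrable (fun θ => θ i) π
  integrable_mul : ∀ i j, Integrable (fun θ => θ i * θ j) π
  mean : ∀ i, ∫ θ, θ i ∂π = 0
  second_moment : ∀ i j, ∫ θ, θ i * θ j ∂π = (1 : Matrix (Fin N) (Fin N) ℝ) i j

/-- `E_θ[Error]` as a function of the design matrix; `θ` is drawn from `π` independently of it. -/
def expectedError (κ : ℝ) {n N : ℕ} (p : ℕ) (π : Measure (Fin N → ℝ))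
    (X : Fin n → Fin N → ℝ) : ℝ :=
  ∫ θ, predictionError κ p (Matrix.of X) θ ∂π

/-- `Z = Y + o_p(Y)`, for random variables `Z k` on probability spaces `(Ω k, P k)` and
deterministic `Y k`. -/
def TendstoInProb {Ω : ℕ → Type*} [∀ k, MeasurableSpace (Ω k)] (P : ∀ k, Measure (Ω k))
    (Z : ∀ k, Ω k → ℝ) (Y : ℕ → ℝ) : Prop :=
  ∀ ε : ℝ, 0 < ε → Tendsto (fun k => P k {ω | ε * |Y k| < |Z k ω - Y k|}) atTop (𝓝 0)

/-- `Z k → +∞` in probability. -/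
def TendstoInfInProb {Ω : ℕ → Type*} [∀ k, MeasurableSpace (Ω k)] (P : ∀ k, Measure (Ω k))
    (Z : ∀ k, Ω k → ℝ) : Prop :=
  ∀ C : ℝ, Tendsto (fun k => P k {ω | Z k ω ≤ C}) atTop (𝓝 0)

/-- `h_κ(a) = β / a - ∫_a^1 t ^ (κ - 2) dt - 1`. -/
def h (κ β a : ℝ) : ℝ := β / a - (∫ t in a..1, t ^ (κ - 2)) - 1

/-- `R_κ(a) = N ^ (1 - κ) * ∫_a^1 t ^ (-κ) dt * β / (β - a)`, with values in `[0, ∞]`, because the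
integral diverges for `a = 0` and `κ ≥ 1`. -/
def asymptoticRisk (κ β : ℝ) (N : ℕ) (a : ℝ) : ℝ≥0∞ :=
  ENNReal.ofReal ((N : ℝ) ^ (1 - κ)) * (∫⁻ t in Set.Ioc a 1, ENNReal.ofReal (t ^ (-κ))) *
    ENNReal.ofReal (β / (β - a))

end

end PCR

/-! The `j`-th column of `X` is `√λ_j z_j`, with independent standard Gaussian vectors `z_j` in
`ℝ^n`. As `α < β`, eventually `p < n` and the estimator is least squares: it is exact on the
selected part of `θ`, and the unselected columns act as noise. Let `f_a` be the family dual to the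
selected `z_a` in their span. The scalings `√λ_a` cancel, and isotropy of `θ` gives `E_θ[Error] =
Σ_k λ_k (1 + Σ_a ⟨f_a, z_k⟩²)`, with `k` unselected and `a` selected
(`expectedError_designOfColumns`).

Given the selected columns, the double sum has mean `S tr G⁻¹`, where `S` is the sum of the
unselected eigenvalues and `G` the Gram matrix of the selected `z_a`. Chebyshev's inequality
(`measure_quadraticForm_deviation_le`) makes the error `o(S)`, because the largest unselected
eigenvalue is negligible against `S`. A diagonal entry of `G⁻¹` is the reciprocal of the squared
distance of `z_a` from the span of the others (`inv_gram_diag_mul_norm_sq`), a chi-square variable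
with `m = n - p + 1` degrees of freedom. A fourth moment bound gives deviation probability `O(m⁻²)`,
so a union over `p = O(m)` indices still tends to `0`. Hence `tr G⁻¹ ≈ p / m → α / (β - α)`, and `1
+ α / (β - α) = β / (β - α)`. Comparison with an integral gives `S ~ N^(1-κ) ∫_α^1 t^(-κ) dt`. When
`α = 0` and `κ ≥ 1`, the bound `S ≤ E_θ[Error]`, valid for every design, already forces divergence.

For the shape, let `I(a) = ∫_a^1 t^(-κ) dt`. The derivative of `I(a) / (β - a)` has the sign of
`riskSlope`, `I(a) - a^(-κ) (β - a)`, which is strictly increasing, negative near `0` and positive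
at `β`; moreover `a h(a) = -a^κ riskSlope(a)`. Differences are compared after cross-multiplication,
which also covers the endpoint `a = 0`. -/

namespace PCR

/-! ### Marginals of standard Gaussian vectors. -/

section Gaussian

variable {E : Type*} [NormedAddCommGroup E] [InnerProductSpace ℝ E] [FiniteDimensional ℝ E]
  [MeasurableSpace E] [BorelSpace E]

/-- Linear functionals of a standard Gaussian vector. -/
lemma stdGaussian_map_inner (v : E) :
    (stdGaussian E).map (fun x => inner ℝ v x) = (gaussianReal 0 1).map (fun x => ‖v‖ * x) := by
  rw [gaussianReal_map_const_mul]
  have : IsProbabilityMeasure ((stdGaussian E).map (fun x => inner ℝ v x)) :=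
    Measure.isProbabilityMeasure_map (by fun_prop)
  apply Measure.ext_of_charFun
  ext t
  have h := charFun_stdGaussian (t • v)
  rw [charFun_apply] at h
  rw [charFun_apply_real, charFun_gaussianReal, integral_map (by fun_prop) (by fun_prop)]
  simp only [real_inner_smul_right] at h
  push_cast at h
  simp only [real_inner_comm] at h ⊢
  rw [h]
  have h2 : (‖t • v‖ : ℂ) ^ 2 = (t : ℂ) ^ 2 * (‖v‖ : ℂ) ^ 2 := by
    rw [norm_smul, Real.norm_eq_abs]
    norm_cast
    rw [mul_pow, sq_abs]
  rw [h2]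
  simp
  ring_nf

lemma stdGaussian_map_orthogonalProjectionOnto (U : Submodule ℝ E) :
    (stdGaussian E).map U.orthogonalProjectionOnto = stdGaussian U := by
  have : IsProbabilityMeasure ((stdGaussian E).map U.orthogonalProjectionOnto) :=
    Measure.isProbabilityMeasure_map (by fun_prop)
  apply Measure.ext_of_charFun
  ext t
  rw [charFun_stdGaussian, charFun_apply, integral_map (by fun_prop) (by fun_prop)]
  have h := charFun_stdGaussian (t : E)
  rw [charFun_apply] at h
  simp_rw [Submodule.inner_orthogonalProjectionOnto_eq_of_mem_right]
  rw [h]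
  simp

end Gaussian

/-! ### Conditioning on all coordinates but one. -/

section Update

variable {ι : Type*} [Fintype ι] [DecidableEq ι] {X : ι → Type*} [∀ i, MeasurableSpace (X i)]
  (μ : ∀ i, Measure (X i)) [∀ i, IsProbabilityMeasure (μ i)]

/-- Resampling one coordinate of a product measure. -/
lemma pi_apply_eq_lintegral_update (a : ι) {s : Set (∀ i, X i)} (hs : MeasurableSet s) :
    Measure.pi μ s = ∫⁻ z, μ a {x | Function.update z a x ∈ s} ∂Measure.pi μ := by
  have key : ∀ z, (∫⋯∫⁻_{a}, s.indicator 1 ∂μ) z = μ a {x | Function.update z a x ∈ s} := by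
    intro z
    simp only [lmarginal_singleton]
    have : (fun x => s.indicator (1 : (∀ i, X i) → ℝ≥0∞) (Function.update z a x)) =
        {x | Function.update z a x ∈ s}.indicator 1 := by
      ext x; simp [Set.indicator]
    rw [this, lintegral_indicator_one]
    exact (measurable_update z) hs
  have hm : Measurable (s.indicator (1 : (∀ i, X i) → ℝ≥0∞)) := measurable_one.indicator hs
  rw [← lintegral_indicator_one hs]
  simp_rw [← key]
  -- The marginal over `a` no longer depends on coordinate `a`, so integrating it over `a` again
  -- leaves it fixed.
  refine lintegral_eq_of_lmarginal_eq {a} hm (hm.lmarginal μ) ?_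
  ext z
  simp [lmarginal_singleton]

/-- This lets one vector be treated as random and the others as fixed, outside a null set of
degenerate configurations. -/
lemma pi_le_of_update_le (a : ι) {s : Set (∀ i, X i)} (hs : MeasurableSet s) {c : ℝ≥0∞}
    (h : ∀ᵐ z ∂Measure.pi μ, μ a {x | Function.update z a x ∈ s} ≤ c) : Measure.pi μ s ≤ c := by
  rw [pi_apply_eq_lintegral_update μ a hs]
  calc _ ≤ ∫⁻ z, c ∂Measure.pi μ := lintegral_mono_ae h
    _ = c := by simp

end Update

/-! ### Moments of i.i.d. sums. -/

section FourthMoment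

lemma integrable_pow_of_memLp {Ω : Type*} [MeasurableSpace Ω] {μ : Measure Ω} [IsFiniteMeasure μ]
    {f : Ω → ℝ} {p : ℕ} (hf : MemLp f p μ) {k : ℕ} (hk : k ≤ p) :
    Integrable (fun x => f x ^ k) μ := by
  have h1 : MemLp f k μ := hf.mono_exponent (by exact_mod_cast hk)
  refine (integrable_norm_iff (by have := h1.1; fun_prop)).1 ?_
  simpa using h1.integrable_norm_pow'

/-- The first, second and fourth moments of a sum of independent centred variables. -/
lemma moments_sum_iid (μ : Measure ℝ) [IsProbabilityMeasure μ] {f : ℝ → ℝ}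
    (hf : MemLp f 4 μ) (h0 : ∫ x, f x ∂μ = 0) (m : ℕ) :
    MemLp (fun x : Fin m → ℝ => ∑ i, f (x i)) 4 (Measure.pi fun _ => μ) ∧
    ∫ x : Fin m → ℝ, (∑ i, f (x i)) ∂(Measure.pi fun _ => μ) = 0 ∧
    ∫ x : Fin m → ℝ, (∑ i, f (x i)) ^ 2 ∂(Measure.pi fun _ => μ) = m * ∫ x, f x ^ 2 ∂μ ∧
    ∫ x : Fin m → ℝ, (∑ i, f (x i)) ^ 4 ∂(Measure.pi fun _ => μ) ≤
      3 * (m : ℝ) ^ 2 * ∫ x, f x ^ 4 ∂μ := by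
  induction m with
  | zero => simp
  | succ m ih =>
    obtain ⟨hS, hS1, hS2, hS4⟩ := ih
    set ν : Measure (Fin m → ℝ) := Measure.pi fun _ => μ
    set S : (Fin m → ℝ) → ℝ := fun x => ∑ i, f (x i) with hSdef
    have hmp := measurePreserving_piFinSuccAbove (fun _ : Fin (m + 1) => μ) 0
    have hL : MemLp (fun z : ℝ × (Fin m → ℝ) => f z.1 + S z.2) 4 (μ.prod ν) :=
      (hf.comp_fst ν).add (hS.comp_snd μ)
    have hcomp : ∀ x : Fin (m + 1) → ℝ, ∑ i, f (x i) =
        (fun z : ℝ × (Fin m → ℝ) => f z.1 + S z.2)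
          (MeasurableEquiv.piFinSuccAbove (fun _ => ℝ) 0 x) := by
      intro x
      rw [Fin.sum_univ_succ]
      rfl
    have hint : ∀ k : ℕ, ∫ x : Fin (m + 1) → ℝ, (∑ i, f (x i)) ^ k ∂(Measure.pi fun _ => μ) =
        ∫ z : ℝ × (Fin m → ℝ), (f z.1 + S z.2) ^ k ∂(μ.prod ν) := by
      intro k
      simp_rw [hcomp]
      exact hmp.integral_comp' (g := fun z : ℝ × (Fin m → ℝ) => (f z.1 + S z.2) ^ k)
    have hfk : ∀ k ≤ 4, Integrable (fun x => f x ^ k) μ := fun k hk =>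
      integrable_pow_of_memLp (p := 4) hf hk
    have hSk : ∀ k ≤ 4, Integrable (fun x => S x ^ k) ν := fun k hk =>
      integrable_pow_of_memLp (p := 4) hS hk
    have hprod : ∀ j k, j ≤ 4 → k ≤ 4 → ∀ c : ℝ,
        Integrable (fun z : ℝ × (Fin m → ℝ) => c * (f z.1 ^ j * S z.2 ^ k)) (μ.prod ν) ∧
        ∫ z : ℝ × (Fin m → ℝ), c * (f z.1 ^ j * S z.2 ^ k) ∂(μ.prod ν) =
          c * ((∫ x, f x ^ j ∂μ) * ∫ x, S x ^ k ∂ν) := fun j k hj hk c =>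
      ⟨((hfk j hj).mul_prod (hSk k hk)).const_mul c, by
        rw [integral_const_mul, integral_prod_mul (fun x => f x ^ j) (fun x => S x ^ k)]⟩
    refine ⟨?_, ?_, ?_, ?_⟩
    · simp_rw [hcomp]
      exact hL.comp_measurePreserving hmp
    · have h1 := hint 1
      simp only [pow_one] at h1
      rw [h1, integral_add ((hf.integrable (by norm_num)).comp_fst ν)
        ((hS.integrable (by norm_num)).comp_snd μ)]
      have a1 := integral_fun_fst (μ := μ) (ν := ν) f
      have a2 := integral_fun_snd (μ := μ) (ν := ν) S
      rw [a1, a2, h0, hS1]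
      simp
    · rw [hint 2]
      have : ∀ z : ℝ × (Fin m → ℝ), (f z.1 + S z.2) ^ 2 = 1 * (f z.1 ^ 2 * S z.2 ^ 0) +
          2 * (f z.1 ^ 1 * S z.2 ^ 1) + 1 * (f z.1 ^ 0 * S z.2 ^ 2) := fun z => by ring
      simp_rw [this]
      rw [integral_add ((hprod 2 0 (by norm_num) (by norm_num) 1).1.fun_add
          (hprod 1 1 (by norm_num) (by norm_num) 2).1)
          (hprod 0 2 (by norm_num) (by norm_num) 1).1,
        integral_add (hprod 2 0 (by norm_num) (by norm_num) 1).1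
          (hprod 1 1 (by norm_num) (by norm_num) 2).1,
        (hprod 2 0 (by norm_num) (by norm_num) 1).2, (hprod 1 1 (by norm_num) (by norm_num) 2).2,
        (hprod 0 2 (by norm_num) (by norm_num) 1).2, hS2]
      simp only [pow_one, h0, hS1]
      simp
      ring
    · rw [hint 4]
      have : ∀ z : ℝ × (Fin m → ℝ), (f z.1 + S z.2) ^ 4 = 1 * (f z.1 ^ 4 * S z.2 ^ 0) +
          4 * (f z.1 ^ 3 * S z.2 ^ 1) + 6 * (f z.1 ^ 2 * S z.2 ^ 2) +
          4 * (f z.1 ^ 1 * S z.2 ^ 3) + 1 * (f z.1 ^ 0 * S z.2 ^ 4) := fun z => by ring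
      simp_rw [this]
      have i1 := hprod 4 0 (by norm_num) (by norm_num) 1
      have i2 := hprod 3 1 (by norm_num) (by norm_num) 4
      have i3 := hprod 2 2 (by norm_num) (by norm_num) 6
      have i4 := hprod 1 3 (by norm_num) (by norm_num) 4
      have i5 := hprod 0 4 (by norm_num) (by norm_num) 1
      rw [integral_add (((i1.1.fun_add i2.1).fun_add i3.1).fun_add i4.1) i5.1,
        integral_add ((i1.1.fun_add i2.1).fun_add i3.1) i4.1,
        integral_add (i1.1.fun_add i2.1) i3.1, integral_add i1.1 i2.1,
        i1.2, i2.2, i3.2, i4.2, i5.2, hS2]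
      simp only [pow_one, h0, hS1]
      -- The variance of `f ^ 2` is nonnegative. The induction then closes because `1 + 6 m + 3 m ^
      -- 2 ≤ 3 (m + 1) ^ 2`.
      have hvar : (∫ x, f x ^ 2 ∂μ) ^ 2 ≤ ∫ x, f x ^ 4 ∂μ := by
        have h2 : MemLp (fun x => f x ^ 2) 2 μ := by
          rw [memLp_two_iff_integrable_sq (hfk 2 (by norm_num)).1]
          simpa [← pow_mul] using hfk 4 le_rfl
        have := variance_nonneg (fun x => f x ^ 2) μ
        rw [variance_eq_sub h2] at this
        simp only [Pi.pow_apply, ← pow_mul] at this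
        linarith
      simp
      nlinarith [(Nat.cast_nonneg m : (0 : ℝ) ≤ m),
        mul_le_mul_of_nonneg_left hvar (Nat.cast_nonneg m : (0 : ℝ) ≤ m),
        sq_nonneg (∫ x, f x ^ 2 ∂μ)]

end FourthMoment

/-! ### Concentration of Gaussian quadratic forms. -/

section Concentration

variable {E : Type*} [NormedAddCommGroup E] [InnerProductSpace ℝ E] [FiniteDimensional ℝ E]
  [MeasurableSpace E] [BorelSpace E]

lemma integrable_pow_gaussianReal (k : ℕ) : Integrable (fun x : ℝ => x ^ k) (gaussianReal 0 1) :=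
  integrable_pow_of_memLp (p := k) (memLp_id_gaussianReal k) le_rfl

lemma integral_sq_gaussianReal : ∫ x : ℝ, x ^ 2 ∂gaussianReal 0 1 = 1 := by
  have h := variance_id_gaussianReal (μ := 0) (v := 1)
  rw [variance_eq_sub (memLp_id_gaussianReal 2)] at h
  simpa using h

lemma integrable_inner_pow (v : E) (k : ℕ) :
    Integrable (fun x : E => (inner ℝ v x) ^ k) (stdGaussian E) := by
  have h : Integrable (fun x : ℝ => x ^ k) ((stdGaussian E).map (fun x => inner ℝ v x)) := by
    rw [stdGaussian_map_inner, integrable_map_measure (by fun_prop) (by fun_prop)]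
    simp only [Function.comp_def, mul_pow]
    exact (integrable_pow_gaussianReal k).const_mul _
  exact h.comp_measurable (by fun_prop)

lemma integral_inner_pow (v : E) (k : ℕ) :
    ∫ x : E, (inner ℝ v x) ^ k ∂stdGaussian E =
      ‖v‖ ^ k * ∫ x : ℝ, x ^ k ∂gaussianReal 0 1 := by
  have h : ∫ x : ℝ, x ^ k ∂((stdGaussian E).map (fun x => inner ℝ v x)) =
      ‖v‖ ^ k * ∫ x : ℝ, x ^ k ∂gaussianReal 0 1 := by
    rw [stdGaussian_map_inner, integral_map (by fun_prop) (by fun_prop)]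
    simp only [mul_pow]
    rw [integral_const_mul]
  rwa [integral_map (by fun_prop) (by fun_prop)] at h

/-- Concentration of the squared norm of the projection of a standard Gaussian vector. -/
lemma measure_projection_deviation_le (V : Submodule ℝ E) (hV : 0 < Module.finrank ℝ V)
    {ε : ℝ} (hε : 0 < ε) :
    stdGaussian E {x | ε * Module.finrank ℝ V ≤
        |‖V.orthogonalProjectionOnto x‖ ^ 2 - Module.finrank ℝ V|} ≤
      ENNReal.ofReal (3 * (∫ x : ℝ, (x ^ 2 - 1) ^ 4 ∂gaussianReal 0 1) /
        (ε ^ 4 * (Module.finrank ℝ V : ℝ) ^ 2)) := by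
  set m := Module.finrank ℝ V with hm
  have hm0 : (0 : ℝ) < m := by exact_mod_cast hV
  set b := stdOrthonormalBasis ℝ V
  have hs : MeasurableSet {y : V | ε * m ≤ |‖y‖ ^ 2 - m|} :=
    measurableSet_le (by fun_prop) (by fun_prop)
  have e1 : stdGaussian E {x | ε * m ≤ |‖V.orthogonalProjectionOnto x‖ ^ 2 - m|} =
      stdGaussian V {y | ε * m ≤ |‖y‖ ^ 2 - m|} := by
    rw [← stdGaussian_map_orthogonalProjectionOnto V, Measure.map_apply (by fun_prop) hs]
    rfl
  have hnorm : ∀ x : Fin m → ℝ, ‖∑ i, x i • b i‖ ^ 2 - m = ∑ i, (x i ^ 2 - 1) := by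
    intro x
    have : ‖∑ i, x i • b i‖ ^ 2 = ∑ i, x i ^ 2 := by
      rw [← real_inner_self_eq_norm_sq, b.orthonormal.inner_sum]
      simp only [sq, conj_trivial]
      rfl
    rw [this]
    simp [hm]
  have hf : MemLp (fun x : ℝ => x ^ 2 - 1) 4 (gaussianReal 0 1) := by
    refine MemLp.sub ?_ (memLp_const 1)
    have h := (memLp_id_gaussianReal (μ := 0) (v := 1) 8).norm_rpow_div (q := 2)
    have e : (8 : ℝ≥0∞) / 2 = 4 := by
      rw [show (8 : ℝ≥0∞) = 4 * 2 by norm_num]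
      exact ENNReal.mul_div_cancel_right (by norm_num) (by norm_num)
    have e8 : ((8 : ℝ≥0) : ℝ≥0∞) = 8 := rfl
    rw [e8, e] at h
    simpa using h
  have h0 : ∫ x : ℝ, (x ^ 2 - 1) ∂gaussianReal 0 1 = 0 := by
    rw [integral_sub (integrable_pow_gaussianReal 2) (integrable_const _),
      integral_sq_gaussianReal]
    simp
  obtain ⟨hS, -, -, hS4⟩ := moments_sum_iid (gaussianReal 0 1) hf h0 m
  set γ : Measure (Fin m → ℝ) := Measure.pi fun _ => gaussianReal 0 1
  have e2 : stdGaussian V {y | ε * m ≤ |‖y‖ ^ 2 - m|} =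
      γ {x | ε * m ≤ |∑ i, (x i ^ 2 - 1)|} := by
    rw [stdGaussian_eq_map_pi_orthonormalBasis b, Measure.map_apply (by fun_prop) hs]
    congr 1
    ext x
    change ε * m ≤ |‖∑ i, x i • b i‖ ^ 2 - m| ↔ ε * m ≤ |∑ i, (x i ^ 2 - 1)|
    rw [hnorm x]
  have hint : Integrable (fun x : Fin m → ℝ => (∑ i, (x i ^ 2 - 1)) ^ 4) γ :=
    integrable_pow_of_memLp (p := 4) hS le_rfl
  -- Markov's inequality for the fourth power: the rate `1 / m ^ 2` survives a later union over a
  -- number of indices of order `m`, where the `1 / m` of Chebyshev would not.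
  have hmk := mul_meas_ge_le_integral_of_nonneg (Eventually.of_forall fun x => by positivity)
    hint ((ε * m) ^ 4)
  rw [e1, e2]
  refine (measure_mono (t := {x | (ε * m) ^ 4 ≤ (∑ i, (x i ^ 2 - 1)) ^ 4}) ?_).trans ?_
  · intro x hx
    simp only [Set.mem_ofPred_eq] at hx ⊢
    rw [← Even.pow_abs (show Even 4 by decide) (∑ i, (x i ^ 2 - 1))]
    gcongr
  · rw [← ENNReal.ofReal_toReal (measure_ne_top γ _)]
    refine ENNReal.ofReal_le_ofReal ?_
    rw [le_div_iff₀ (by positivity)]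
    have h2 := hmk.trans hS4
    rw [measureReal_def] at h2
    have h3 : (m : ℝ) ^ 2 * ((γ {x | (ε * m) ^ 4 ≤ (∑ i, (x i ^ 2 - 1)) ^ 4}).toReal *
        (ε ^ 4 * m ^ 2)) ≤
        (m : ℝ) ^ 2 * (3 * ∫ x : ℝ, (x ^ 2 - 1) ^ 4 ∂gaussianReal 0 1) := by
      calc _ = (ε * m) ^ 4 * (γ {x | (ε * m) ^ 4 ≤ (∑ i, (x i ^ 2 - 1)) ^ 4}).toReal := by ring
        _ ≤ _ := h2
        _ = _ := by ring
    exact le_of_mul_le_mul_left h3 (by positivity)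

/-- Chebyshev's inequality for a weighted sum of independent Gaussian quadratic forms. -/
lemma measure_quadraticForm_deviation_le {A C : Type*} [Fintype A] [Fintype C] (f : A → E)
    (l : C → ℝ) {η : ℝ} (hη : 0 < η) :
    (Measure.pi fun _ : C => stdGaussian E)
      {z | η ≤ |∑ c, l c * ∑ a, inner ℝ (f a) (z c) ^ 2 - (∑ c, l c) * ∑ a, ‖f a‖ ^ 2|} ≤
      ENNReal.ofReal ((∫ x : ℝ, x ^ 4 ∂gaussianReal 0 1) * (∑ c, l c ^ 2) *
        (∑ a, ‖f a‖ ^ 2) ^ 2 / η ^ 2) := by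
  set τ := ∑ a, ‖f a‖ ^ 2
  -- In this proof `κ` is the fourth Gaussian moment, not the decay exponent.
  set κ := ∫ x : ℝ, x ^ 4 ∂gaussianReal 0 1
  set q : E → ℝ := fun x => ∑ a, inner ℝ (f a) x ^ 2 with hq
  -- Cauchy–Schwarz with weights `‖f a‖ ^ 2` avoids the mixed moments of correlated coordinates.
  -- Terms with `f a = 0` are harmless, since division by zero gives `0`.
  have hpt : ∀ x, q x ^ 2 ≤ τ * ∑ a, inner ℝ (f a) x ^ 4 / ‖f a‖ ^ 2 := by
    intro x
    refine Finset.sum_sq_le_sum_mul_sum_of_sq_le_mul _ (fun _ _ => by positivity)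
      (fun _ _ => by positivity) fun a _ => le_of_eq ?_
    rcases eq_or_ne (f a) 0 with h | h
    · simp [h]
    · have : ‖f a‖ ≠ 0 := norm_ne_zero_iff.2 h
      field_simp
  have hint : Integrable (fun x => τ * ∑ a, inner ℝ (f a) x ^ 4 / ‖f a‖ ^ 2) (stdGaussian E) :=
    (integrable_finsetSum _ fun a _ => (integrable_inner_pow (f a) 4).div_const _).const_mul _
  have hqm : Measurable q := by fun_prop
  have hq2 : Integrable (fun x => q x ^ 2) (stdGaussian E) :=
    hint.mono' (by fun_prop) (Eventually.of_forall fun x => by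
      rw [Real.norm_of_nonneg (by positivity)]; exact hpt x)
  have hqL : MemLp q 2 (stdGaussian E) :=
    (memLp_two_iff_integrable_sq hqm.aestronglyMeasurable).2 hq2
  have hmean : ∫ x, q x ∂stdGaussian E = τ := by
    rw [integral_finsetSum _ fun a _ => integrable_inner_pow (f a) 2]
    simp_rw [integral_inner_pow, integral_sq_gaussianReal, mul_one]
    rfl
  have hsecond : ∫ x, q x ^ 2 ∂stdGaussian E ≤ κ * τ ^ 2 := by
    refine (integral_mono hq2 hint hpt).trans ?_
    rw [integral_const_mul, integral_finsetSum _ fun a _ =>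
      (integrable_inner_pow (f a) 4).div_const _]
    simp_rw [integral_div, integral_inner_pow]
    have : ∑ a, ‖f a‖ ^ 4 * κ / ‖f a‖ ^ 2 = κ * τ := by
      rw [Finset.mul_sum]
      refine Finset.sum_congr rfl fun a _ => ?_
      rcases eq_or_ne (f a) 0 with h | h
      · simp [h]
      · have : ‖f a‖ ≠ 0 := norm_ne_zero_iff.2 h
        field_simp
    rw [this]
    exact le_of_eq (by ring)
  have hvar : Var[q; stdGaussian E] ≤ κ * τ ^ 2 := by
    rw [variance_eq_sub hqL]
    have : (∫ x, (q ^ 2) x ∂stdGaussian E) ≤ κ * τ ^ 2 := hsecond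
    nlinarith [sq_nonneg (∫ x, q x ∂stdGaussian E)]
  set P := Measure.pi fun _ : C => stdGaussian E
  set X : (C → E) → ℝ := ∑ c, fun z : C → E => (fun x => l c * q x) (z c) with hX
  have hXL : MemLp X 2 P := memLp_finsetSum' _ fun c _ =>
    (hqL.const_mul (l c)).comp_measurePreserving (measurePreserving_eval _ c)
  have hXmean : ∫ z, X z ∂P = (∑ c, l c) * τ := by
    simp only [hX, Finset.sum_apply]
    have hi : ∀ c ∈ Finset.univ, Integrable (fun z : C → E => l c * q (z c)) P := fun c _ =>
      ((hqL.const_mul (l c)).comp_measurePreserving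
        (measurePreserving_eval (fun _ : C => stdGaussian E) c)).integrable (by norm_num)
    rw [integral_finsetSum _ hi, Finset.sum_mul]
    refine Finset.sum_congr rfl fun c _ => ?_
    have := integral_comp_eval (μ := fun _ : C => stdGaussian E) (i := c)
      (f := fun x => l c * q x) (by fun_prop)
    rw [this, integral_const_mul, hmean]
  have hXvar : Var[X; P] ≤ κ * (∑ c, l c ^ 2) * τ ^ 2 := by
    rw [variance_sum_pi fun c => hqL.const_mul (l c)]
    simp_rw [variance_const_mul]
    rw [mul_assoc, mul_left_comm, Finset.sum_mul]
    exact Finset.sum_le_sum fun c _ => mul_le_mul_of_nonneg_left hvar (by positivity)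
  have hch := meas_ge_le_variance_div_sq hXL hη
  rw [hXmean] at hch
  have hset : {z : C → E | η ≤ |∑ c, l c * ∑ a, inner ℝ (f a) (z c) ^ 2 - (∑ c, l c) * τ|} =
      {z | η ≤ |X z - (∑ c, l c) * τ|} := by
    simp [hX, hq]
  rw [hset]
  refine hch.trans (ENNReal.ofReal_le_ofReal ?_)
  gcongr

end Concentration

/-! ### Dual families and the inverse Gram matrix. -/

section GramMatrix

variable {E : Type*} [NormedAddCommGroup E] [InnerProductSpace ℝ E]
  {ι : Type*} [Fintype ι] [DecidableEq ι]

/-- The family dual to `g` inside its span. -/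
noncomputable def dualFamily (g : ι → E) (a : ι) : E := ∑ b, (gram ℝ g)⁻¹ a b • g b

lemma inner_dualFamily {g : ι → E} (hg : LinearIndependent ℝ g) (a c : ι) :
    inner ℝ (dualFamily g a) (g c) = (1 : Matrix ι ι ℝ) a c := by
  have hdet : IsUnit (gram ℝ g).det := isUnit_iff_ne_zero.2
    (det_gram_ne_zero_iff_linearIndependent.2 hg)
  rw [← nonsing_inv_mul _ hdet]
  simp [dualFamily, sum_inner, Matrix.mul_apply, gram_apply, real_inner_smul_left]

lemma inv_gram_symm (g : ι → E) (a b : ι) : (gram ℝ g)⁻¹ a b = (gram ℝ g)⁻¹ b a := by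
  have h : ((gram ℝ g)⁻¹).IsHermitian := (isHermitian_gram ℝ g).inv
  simpa using (h.apply a b).symm

lemma sum_gram_smul_dualFamily {g : ι → E} (hg : LinearIndependent ℝ g) (a : ι) :
    ∑ b, gram ℝ g a b • dualFamily g b = g a := by
  have hdet : IsUnit (gram ℝ g).det := isUnit_iff_ne_zero.2
    (det_gram_ne_zero_iff_linearIndependent.2 hg)
  simp_rw [dualFamily, Finset.smul_sum, smul_smul]
  rw [Finset.sum_comm]
  simp_rw [← Finset.sum_smul, ← Matrix.mul_apply, mul_nonsing_inv _ hdet]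
  simp [Matrix.one_apply]

lemma inner_dualFamily_dualFamily {g : ι → E} (hg : LinearIndependent ℝ g) (a b : ι) :
    inner ℝ (dualFamily g a) (dualFamily g b) = (gram ℝ g)⁻¹ a b := by
  rw [dualFamily.eq_1 g b, inner_sum]
  simp_rw [real_inner_smul_right, inner_dualFamily hg]
  simp [Matrix.one_apply, inv_gram_symm g a b]

/-- The dual vector at `a` is orthogonal to the other `g b`, so projecting its expansion onto their
orthogonal complement leaves only the term of `g a`. Pairing it with `g a` gives `1`. -/
lemma inv_gram_diag_mul_norm_sq [FiniteDimensional ℝ E] {g : ι → E}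
    (hg : LinearIndependent ℝ g) (a : ι) :
    (gram ℝ g)⁻¹ a a *
      ‖(Submodule.span ℝ (g '' {a}ᶜ))ᗮ.orthogonalProjectionOnto (g a)‖ ^ 2 = 1 := by
  set V := (Submodule.span ℝ (g '' {a}ᶜ))ᗮ with hV
  have hf : dualFamily g a ∈ V := by
    rw [hV, Submodule.mem_orthogonal']
    intro u hu
    induction hu using Submodule.span_induction with
    | mem x hx =>
      obtain ⟨b, hb, rfl⟩ := hx
      rw [inner_dualFamily hg, Matrix.one_apply_ne (Ne.symm hb)]
    | zero => simp
    | add x y _ _ hx hy => rw [inner_add_right, hx, hy, add_zero]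
    | smul c x _ hx => rw [real_inner_smul_right, hx, mul_zero]
  have hP : (V.orthogonalProjectionOnto (dualFamily g a) : V) =
      (gram ℝ g)⁻¹ a a • V.orthogonalProjectionOnto (g a) := by
    rw [dualFamily, map_sum, Finset.sum_eq_single a]
    · simp
    · intro b _ hb
      have : V.orthogonalProjectionOnto (g b) = 0 := by
        rw [Submodule.orthogonalProjectionOnto_eq_zero_iff, hV, Submodule.orthogonal_orthogonal]
        exact Submodule.subset_span ⟨b, hb, rfl⟩
      rw [map_smul, this, smul_zero]
    · simp
  have h1 : inner ℝ (dualFamily g a) (g a) = 1 := by rw [inner_dualFamily hg]; simp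
  have h2 : inner ℝ (dualFamily g a) (g a) =
      inner ℝ (V.orthogonalProjectionOnto (dualFamily g a)) (V.orthogonalProjectionOnto (g a)) := by
    rw [Submodule.inner_orthogonalProjectionOnto_eq_of_mem_left,
      ← Submodule.starProjection_apply, Submodule.starProjection_eq_self_iff.2 hf]
  rw [h2, hP, real_inner_smul_left, real_inner_self_eq_norm_sq] at h1
  exact h1

end GramMatrix

/-- Supplies the measurability needed to resample one vector. -/
lemma isOpen_setOf_linearIndepOn {E : Type*} [NormedAddCommGroup E] [InnerProductSpace ℝ E]
    {ι : Type*} [Fintype ι] (t : Finset ι) :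
    IsOpen {z : ι → E | LinearIndepOn ℝ z (t : Set ι)} :=
  (isOpen_setOfPred_linearIndependent (𝕜 := ℝ) (E := E) (ι := (t : Set ι))).preimage
    (f := fun (z : ι → E) (i : (t : Set ι)) => z i) (by fun_prop)

/-! ### Concentration of the trace of the inverse Gram matrix. -/

section GramConcentration

variable {E : Type*} [NormedAddCommGroup E] [InnerProductSpace ℝ E] [FiniteDimensional ℝ E]
  [MeasurableSpace E] [BorelSpace E]
  {ι : Type*} [Fintype ι] [DecidableEq ι]

/-- A proper subspace is orthogonal to some `v ≠ 0`, and `⟨v, x⟩` is a nondegenerate Gaussian, which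
has no atom at `0`. -/
lemma stdGaussian_submodule_eq_zero {U : Submodule ℝ E} (hU : U ≠ ⊤) :
    stdGaussian E (U : Set E) = 0 := by
  obtain ⟨v, hv, hv0⟩ := (Submodule.ne_bot_iff _).1
    (mt Submodule.orthogonal_eq_bot_iff.1 hU)
  have h : (stdGaussian E).map (fun x => inner ℝ v x) {0} = 0 := by
    rw [stdGaussian_map_inner, Measure.map_apply (by fun_prop) (by measurability)]
    have : (fun x : ℝ => ‖v‖ * x) ⁻¹' {0} = {0} := by
      ext x; simp [hv0]
    rw [this]
    have := nullSingletonClass_gaussianReal (μ := 0) (v := 1) one_ne_zero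
    exact measure_singleton _
  rw [Measure.map_apply (by fun_prop) (by measurability)] at h
  refine measure_mono_null (fun x hx => ?_) h
  exact (Submodule.mem_orthogonal' U v).1 hv x hx

/-- Independent standard Gaussian vectors are almost surely linearly independent. -/
lemma ae_linearIndepOn (t : Finset ι) (ht : t.card ≤ Module.finrank ℝ E) :
    ∀ᵐ z ∂Measure.pi fun _ : ι => stdGaussian E, LinearIndepOn ℝ z (t : Set ι) := by
  induction t using Finset.induction_on with
  | empty => simp
  | insert a t ha ih =>
    rw [Finset.card_insert_of_notMem ha] at ht
    rw [ae_iff, ← nonpos_iff_eq_zero]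
    refine pi_le_of_update_le _ a (isOpen_setOf_linearIndepOn _).measurableSet.compl ?_
    filter_upwards [ih (by omega)] with z hz
    -- The vectors indexed by `t` are too few to span, so the resampled vector almost surely avoids
    -- their span.
    have hne : Submodule.span ℝ (z '' (t : Set ι)) ≠ ⊤ := by
      intro h
      classical
      have h1 := finrank_span_finset_le_card (R := ℝ) (t.image z)
      rw [Finset.coe_image, Set.finrank, h, finrank_top] at h1
      have := Finset.card_image_le (s := t) (f := z)
      omega
    refine (measure_mono fun x hx => ?_).trans (stdGaussian_submodule_eq_zero hne).le
    by_contra hx'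
    apply hx
    have heq : Set.EqOn (Function.update z a x) z t := fun b hb =>
      Function.update_of_ne (by rintro rfl; exact ha hb) _ _
    rw [Finset.coe_insert]
    change LinearIndepOn ℝ (Function.update z a x) _
    rw [linearIndepOn_insert (by simpa using ha)]
    refine ⟨hz.congr heq.symm, ?_⟩
    rw [heq.image_eq]
    simpa using hx'

lemma measurable_inv_gram (a b : ι) :
    Measurable fun g : ι → E => (gram ℝ g)⁻¹ a b := by
  have hg : Continuous fun g : ι → E => gram ℝ g :=
    continuous_matrix fun i j => by simp only [gram_apply]; fun_prop
  simp only [Matrix.inv_def, Matrix.smul_apply, smul_eq_mul, Ring.inverse_eq_inv']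
  exact hg.matrix_det.measurable.inv.mul (hg.matrix_adjugate.matrix_elem a b).measurable

/-- With the other vectors fixed, the reciprocal diagonal entry is the squared norm of a Gaussian
projection onto their orthogonal complement, whose dimension is `finrank - (card - 1) = m`. -/
lemma measure_inv_gram_diag_deviation_le (a : ι) {m : ℕ} (hm : 0 < m)
    (hcard : Fintype.card ι + m = Module.finrank ℝ E + 1) {ε : ℝ} (hε : 0 < ε) (hε1 : ε ≤ 1) :
    (Measure.pi fun _ : ι => stdGaussian E)
      {g | ε * m ≤ |((gram ℝ g)⁻¹ a a)⁻¹ - m|} ≤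
      ENNReal.ofReal (3 * (∫ x : ℝ, (x ^ 2 - 1) ^ 4 ∂gaussianReal 0 1) / (ε ^ 4 * (m : ℝ) ^ 2)) := by
  have hmeas : MeasurableSet {g : ι → E | ε * m ≤ |((gram ℝ g)⁻¹ a a)⁻¹ - m|} :=
    measurableSet_le measurable_const (((measurable_inv_gram a a).inv.sub_const _).abs)
  refine pi_le_of_update_le _ a hmeas ?_
  have hpos : 0 < Fintype.card ι := Fintype.card_pos_iff.2 ⟨a⟩
  have hc : (Finset.univ.erase a).card = Fintype.card ι - 1 := by simp
  filter_upwards [ae_linearIndepOn (E := E) (Finset.univ.erase a) (by omega)] with z hz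
  have hco : ((Finset.univ.erase a : Finset ι) : Set ι) = {a}ᶜ := by ext; simp
  set V := (Submodule.span ℝ (z '' {a}ᶜ))ᗮ with hV
  have hfr : Module.finrank ℝ V = m := by
    have h1 := finrank_span_eq_card hz
    have h2 := Submodule.finrank_add_finrank_orthogonal (Submodule.span ℝ (z '' {a}ᶜ))
    have h3 : Set.range (fun i : ((Finset.univ.erase a : Finset ι) : Set ι) => z i) = z '' {a}ᶜ := by
      rw [← hco, Set.image_eq_range]
    rw [h3] at h1
    simp only [Finset.coe_sort_coe, Fintype.card_coe, hc] at h1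
    rw [← hV, h1] at h2
    omega
  have key := measure_projection_deviation_le V (by omega) hε
  rw [hfr] at key
  refine (measure_mono fun x hx => ?_).trans key
  have heq : (Function.update z a x) '' {a}ᶜ = z '' {a}ᶜ :=
    Set.EqOn.image_eq fun b hb => Function.update_of_ne hb _ _
  change ε * m ≤ |_ - (m : ℝ)|
  change ε * m ≤ |_ - (m : ℝ)| at hx
  by_cases hli : LinearIndependent ℝ (Function.update z a x)
  · have h := inv_gram_diag_mul_norm_sq hli a
    rw [heq, Function.update_self] at h
    rwa [eq_inv_of_mul_eq_one_left h, inv_inv] at hx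
  -- In the dependent case the projection vanishes, so its deviation is `m ≥ ε * m` and the case
  -- lies inside the bounded event.
  · have hmem : x ∈ Submodule.span ℝ (z '' {a}ᶜ) := by
      by_contra hx'
      apply hli
      rw [← linearIndepOn_univ_iff, show (Set.univ : Set ι) = insert a {a}ᶜ by ext b; simp [em],
        linearIndepOn_insert (by simp), heq, Function.update_self]
      exact ⟨(hco ▸ hz).congr fun b hb => (Function.update_of_ne hb _ _).symm, hx'⟩
    have : V.orthogonalProjectionOnto x = 0 := by
      rw [Submodule.orthogonalProjectionOnto_eq_zero_iff, hV, Submodule.orthogonal_orthogonal]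
      exact hmem
    rw [this]
    simp
    nlinarith [(Nat.cast_nonneg m : (0 : ℝ) ≤ m)]

/-- The trace of the inverse Gram matrix of standard Gaussian vectors concentrates, and the
vectors are linearly independent, with high probability. -/
lemma measure_trace_inv_gram_deviation_le {m : ℕ} (hm : 0 < m)
    (hcard : Fintype.card ι + m = Module.finrank ℝ E + 1) {ε : ℝ} (hε : 0 < ε) (hε1 : ε < 1) :
    (Measure.pi fun _ : ι => stdGaussian E)
      {g | ¬ (LinearIndependent ℝ g ∧
        (Fintype.card ι : ℝ) / m * (1 + ε)⁻¹ ≤ (gram ℝ g)⁻¹.trace ∧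
        (gram ℝ g)⁻¹.trace ≤ (Fintype.card ι : ℝ) / m * (1 - ε)⁻¹)} ≤
      Fintype.card ι * ENNReal.ofReal
        (3 * (∫ x : ℝ, (x ^ 2 - 1) ^ 4 ∂gaussianReal 0 1) / (ε ^ 4 * (m : ℝ) ^ 2)) := by
  set P := Measure.pi fun _ : ι => stdGaussian E
  have hm0 : (0 : ℝ) < m := by exact_mod_cast hm
  calc _ ≤ P (⋃ a : ι, {g | ε * m ≤ |((gram ℝ g)⁻¹ a a)⁻¹ - m|}) := by
        refine measure_mono fun g hg => ?_
        by_contra hcon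
        simp only [Set.mem_iUnion, not_exists] at hcon
        have hcon' : ∀ a, |((gram ℝ g)⁻¹ a a)⁻¹ - m| < ε * m := fun a => not_le.1 (hcon a)
        apply hg
        have hb : ∀ a, (m : ℝ)⁻¹ * (1 + ε)⁻¹ ≤ (gram ℝ g)⁻¹ a a ∧
            (gram ℝ g)⁻¹ a a ≤ (m : ℝ)⁻¹ * (1 - ε)⁻¹ := by
          intro a
          obtain ⟨h1, h2⟩ := abs_lt.1 (hcon' a)
          have h3 : (m : ℝ) * (1 - ε) ≤ ((gram ℝ g)⁻¹ a a)⁻¹ := by linarith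
          have h4 : ((gram ℝ g)⁻¹ a a)⁻¹ ≤ m * (1 + ε) := by linarith
          have h5 : 0 < (m : ℝ) * (1 - ε) := mul_pos hm0 (by linarith)
          rw [← mul_inv, ← mul_inv]
          exact ⟨by simpa using inv_anti₀ (h5.trans_le h3) h4, by simpa using inv_anti₀ h5 h3⟩
        refine ⟨?_, ?_, ?_⟩
        · by_contra hli
          rcases isEmpty_or_nonempty ι with he | ⟨⟨a⟩⟩
          · exact hli linearIndependent_empty_type
          · have hdet : (gram ℝ g).det = 0 := by
              by_contra h
              exact hli (det_gram_ne_zero_iff_linearIndependent.1 h)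
            -- A singular Gram matrix has inverse `0` by convention; the deviation is then `m > ε *
            -- m`, which is excluded. Control of the diagonal thus yields independence too.
            have h0 : (gram ℝ g)⁻¹ = 0 := nonsing_inv_apply_not_isUnit _ (by simp [hdet])
            have := hcon' a
            rw [h0] at this
            simp at this
            nlinarith
        · calc (Fintype.card ι : ℝ) / m * (1 + ε)⁻¹ = ∑ _a : ι, (m : ℝ)⁻¹ * (1 + ε)⁻¹ := by
                simp; ring
            _ ≤ _ := Finset.sum_le_sum fun a _ => (hb a).1
        · calc (gram ℝ g)⁻¹.trace ≤ ∑ _a : ι, (m : ℝ)⁻¹ * (1 - ε)⁻¹ :=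
                Finset.sum_le_sum fun a _ => (hb a).2
            _ = _ := by simp; ring
    _ ≤ ∑ a : ι, P {g | ε * m ≤ |((gram ℝ g)⁻¹ a a)⁻¹ - m|} := measure_iUnion_fintype_le _ _
    _ ≤ ∑ _a : ι, _ := Finset.sum_le_sum fun a _ =>
        measure_inv_gram_diag_deviation_le a hm hcard hε hε1.le
    _ = _ := by simp

end GramConcentration

/-! ### From independent rows to independent columns. -/

section Transpose

lemma pi_pi_eq_map_curry {ι κ : Type*} [Fintype ι] [Fintype κ] (μ : ι → κ → Measure ℝ)
    [∀ i j, IsProbabilityMeasure (μ i j)] :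
    (Measure.pi fun i => Measure.pi fun j => μ i j) =
      (Measure.pi fun q : ι × κ => μ q.1 q.2).map (fun z i j => z (i, j)) := by
  have := Measure.infinitePi_map_curry μ
  simp only [Measure.infinitePi_eq_pi] at this
  rw [← this]
  rfl

lemma pi_map_transpose {ι κ : Type*} [Fintype ι] [Fintype κ] (μ : ι → κ → Measure ℝ)
    [∀ i j, IsProbabilityMeasure (μ i j)] :
    (Measure.pi fun i => Measure.pi fun j => μ i j).map (fun z j i => z i j) =
      Measure.pi fun j => Measure.pi fun i => μ i j := by
  rw [pi_pi_eq_map_curry μ, pi_pi_eq_map_curry fun j i => μ i j,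
    Measure.map_map (by fun_prop) (by fun_prop)]
  have h2 := Measure.pi_map_piCongrLeft (Equiv.prodComm ι κ) (fun q : κ × ι => μ q.2 q.1)
  rw [← h2, Measure.map_map (by fun_prop) (by fun_prop)]
  congr 1

lemma eigenvalue_pos (κ : ℝ) (j : ℕ) : 0 < eigenvalue κ j := by
  unfold eigenvalue; positivity

/-- The design matrix with given standardized columns. -/
noncomputable def designOfColumns (κ : ℝ) {n N : ℕ} (z : Fin N → EuclideanSpace ℝ (Fin n)) :
    Fin n → Fin N → ℝ :=
  fun i j => √(eigenvalue κ j) * z j i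

lemma measurable_designOfColumns (κ : ℝ) {n N : ℕ} :
    Measurable (designOfColumns κ : (Fin N → EuclideanSpace ℝ (Fin n)) → _) := by
  unfold designOfColumns
  fun_prop

lemma designLaw_eq_map (κ : ℝ) (n N : ℕ) :
    designLaw κ n N = (Measure.pi fun _ : Fin N => stdGaussian (EuclideanSpace ℝ (Fin n))).map
      (designOfColumns κ) := by
  have h1 : designLaw κ n N =
      Measure.pi fun _ : Fin n => Measure.pi fun j : Fin N =>
        (gaussianReal 0 1).map (fun x => √(eigenvalue κ j) * x) := by
    unfold designLaw featureLaw
    congr; ext1 i; congr; ext1 j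
    rw [gaussianReal_map_const_mul]
    congr 1
    · simp
    · ext
      simp [(eigenvalue_pos κ j).le]
  have hP : ∀ j : Fin N, IsProbabilityMeasure ((gaussianReal 0 1).map
      (fun x => √(eigenvalue κ j) * x)) := fun j => Measure.isProbabilityMeasure_map (by fun_prop)
  rw [h1, ← pi_map_transpose (fun (j : Fin N) (_ : Fin n) => (gaussianReal 0 1).map
      (fun x => √(eigenvalue κ j) * x))]
  simp_rw [← map_pi_eq_stdGaussian]
  rw [← Measure.pi_map_pi (by fun_prop),
    Measure.map_map (measurable_designOfColumns κ) (by fun_prop)]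
  have h2 : ∀ j : Fin N, (Measure.pi fun _ : Fin n => (gaussianReal 0 1).map
      (fun x => √(eigenvalue κ j) * x)) =
      (Measure.pi fun _ : Fin n => gaussianReal 0 1).map
        (fun z i => √(eigenvalue κ j) * z i) := fun j =>
    (Measure.pi_map_pi (by fun_prop)).symm
  have hP2 : ∀ j : Fin N, SigmaFinite ((Measure.pi fun _ : Fin n => gaussianReal 0 1).map
        (fun z i => √(eigenvalue κ j) * z i)) := fun j => by rw [← h2]; infer_instance
  simp_rw [h2]
  rw [← Measure.pi_map_pi fun j => Measurable.aemeasurable (by fun_prop),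
    Measure.map_map (by fun_prop) (by fun_prop)]
  rfl

end Transpose

/-! ### Exact formula for the expected error. -/

section ErrorFormula

lemma integral_dotProduct_sq (κ : ℝ) {N : ℕ} (v : Fin N → ℝ) :
    ∫ x, (x ⬝ᵥ v) ^ 2 ∂featureLaw κ N = ∑ j : Fin N, eigenvalue κ j * v j ^ 2 := by
  have hL : ∀ j : Fin N, MemLp (fun x : ℝ => v j * x) 2
      (gaussianReal 0 (eigenvalue κ j).toNNReal) := fun j => (memLp_id_gaussianReal 2).const_mul _
  have hLc : ∀ j : Fin N, MemLp (fun x : Fin N → ℝ => v j * x j) 2 (featureLaw κ N) := fun j =>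
    (hL j).comp_measurePreserving (measurePreserving_eval _ j)
  have hp : IsProbabilityMeasure (featureLaw κ N) := by unfold featureLaw; infer_instance
  have hvar := variance_sum_pi hL
  have hsum : (∑ j : Fin N, fun x : Fin N → ℝ => v j * x j) = fun x => x ⬝ᵥ v := by
    ext x
    simp [dotProduct, mul_comm]
  have hmean : ∫ x, x ⬝ᵥ v ∂featureLaw κ N = 0 := by
    have hpt : ∀ x : Fin N → ℝ, x ⬝ᵥ v = ∑ j, v j * x j := fun x => by
      simp [dotProduct, mul_comm]
    simp_rw [hpt]
    rw [integral_finsetSum _ fun j _ => (hLc j).integrable (by norm_num)]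
    refine Finset.sum_eq_zero fun j _ => ?_
    rw [integral_const_mul]
    have := integral_comp_eval (μ := fun j : Fin N => gaussianReal 0 (eigenvalue κ j).toNNReal)
      (i := j) (f := fun x => x) (by fun_prop)
    unfold featureLaw
    rw [this]
    simp
  have hLs : MemLp (fun x : Fin N → ℝ => x ⬝ᵥ v) 2 (featureLaw κ N) := by
    rw [← hsum]
    exact memLp_finsetSum' _ fun j _ => hLc j
  rw [hsum] at hvar
  change Var[_; featureLaw κ N] = _ at hvar
  rw [variance_eq_sub hLs, hmean] at hvar
  simp only [Pi.pow_apply] at hvar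
  rw [zero_pow two_ne_zero, sub_zero] at hvar
  rw [hvar]
  refine Finset.sum_congr rfl fun j _ => ?_
  rw [variance_const_mul, variance_fun_id_gaussianReal, Real.coe_toNNReal _ (eigenvalue_pos κ j).le]
  ring

/-- The selected part of the estimator is a linear function of the responses. -/
noncomputable def selectedMatrix {n N : ℕ} (p : ℕ) (X : Matrix (Fin n) (Fin N) ℝ) :
    Matrix {j : Fin N // (j : ℕ) < p} (Fin n) ℝ :=
  if p ≤ n then ((firstCols p X)ᵀ * firstCols p X)⁻¹ * (firstCols p X)ᵀ
  else (firstCols p X)ᵀ * (firstCols p X * (firstCols p X)ᵀ)⁻¹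

/-- The map taking the regression vector to the residual of the estimator. -/
noncomputable def residualMatrix {n N : ℕ} (p : ℕ) (X : Matrix (Fin n) (Fin N) ℝ) :
    Matrix (Fin N) (Fin N) ℝ :=
  fun j k => (1 : Matrix (Fin N) (Fin N) ℝ) j k -
    if h : (j : ℕ) < p then (selectedMatrix p X * X) ⟨j, h⟩ k else 0

lemma sub_estimator_eq {n N : ℕ} (p : ℕ) (X : Matrix (Fin n) (Fin N) ℝ) (θ : Fin N → ℝ) :
    θ - estimator p X (X *ᵥ θ) = residualMatrix p X *ᵥ θ := by
  have hsel : selectedCoef p X (X *ᵥ θ) = (selectedMatrix p X * X) *ᵥ θ := by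
    unfold selectedCoef selectedMatrix
    split_ifs <;> simp only [mulVec_mulVec]
  have hres : residualMatrix p X = 1 - Matrix.of (fun j k : Fin N =>
      if h : (j : ℕ) < p then (selectedMatrix p X * X) ⟨j, h⟩ k else 0) := rfl
  rw [hres, sub_mulVec, one_mulVec]
  congr 1
  ext j
  by_cases hj : (j : ℕ) < p
  · simp [estimator, hsel, mulVec, dotProduct, dif_pos hj]
  · simp [estimator, mulVec, dotProduct, dif_neg hj]

lemma predictionError_eq (κ : ℝ) {n N : ℕ} (p : ℕ) (X : Matrix (Fin n) (Fin N) ℝ)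
    (θ : Fin N → ℝ) :
    predictionError κ p X θ = ∑ j : Fin N, eigenvalue κ j * (residualMatrix p X *ᵥ θ) j ^ 2 := by
  rw [← integral_dotProduct_sq, ← sub_estimator_eq]
  simp [predictionError, dotProduct_sub]

lemma integral_mulVec_sq {N : ℕ} {π : Measure (Fin N → ℝ)} (hπ : IsIsotropic π)
    (w : Fin N → ℝ) :
    Integrable (fun θ => (∑ k, w k * θ k) ^ 2) π ∧
    ∫ θ, (∑ k, w k * θ k) ^ 2 ∂π = ∑ k, w k ^ 2 := by
  have h : ∀ θ : Fin N → ℝ, (∑ k, w k * θ k) ^ 2 =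
      ∑ k, ∑ l, w k * w l * (θ k * θ l) := by
    intro θ
    rw [sq, Finset.sum_mul_sum]
    exact Finset.sum_congr rfl fun k _ => Finset.sum_congr rfl fun l _ => by ring
  have hi : ∀ k l, Integrable (fun θ : Fin N → ℝ => w k * w l * (θ k * θ l)) π := fun k l =>
    (hπ.integrable_mul k l).const_mul _
  simp_rw [h]
  refine ⟨integrable_finsetSum _ fun k _ => integrable_finsetSum _ fun l _ => hi k l, ?_⟩
  rw [integral_finsetSum _ fun k _ => integrable_finsetSum _ fun l _ => hi k l]
  refine Finset.sum_congr rfl fun k _ => ?_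
  rw [integral_finsetSum _ fun l _ => hi k l]
  simp_rw [integral_const_mul, hπ.second_moment]
  simp [Matrix.one_apply, sq]

lemma expectedError_eq_sum (κ : ℝ) {n N : ℕ} (p : ℕ) {π : Measure (Fin N → ℝ)}
    (hπ : IsIsotropic π) (X : Fin n → Fin N → ℝ) :
    expectedError κ p π X =
      ∑ j : Fin N, eigenvalue κ j * ∑ k, residualMatrix p (Matrix.of X) j k ^ 2 := by
  have h : ∀ j, Integrable (fun θ => (residualMatrix p (Matrix.of X) *ᵥ θ) j ^ 2) π ∧
      ∫ θ, (residualMatrix p (Matrix.of X) *ᵥ θ) j ^ 2 ∂π =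
        ∑ k, residualMatrix p (Matrix.of X) j k ^ 2 := fun j => integral_mulVec_sq hπ _
  simp only [expectedError, predictionError_eq]
  rw [integral_finsetSum _ fun j _ => (h j).1.const_mul _]
  simp_rw [integral_const_mul, (h _).2]

/-- The sum of the eigenvalues that are not selected. -/
noncomputable def tailSum (κ : ℝ) (p N : ℕ) : ℝ :=
  ∑ k : {j : Fin N // ¬ (j : ℕ) < p}, eigenvalue κ k

/-- On an unselected coordinate the estimator is zero, so the residual row is a row of the identity.
No rank condition on `X` is needed. -/
lemma tailSum_le_expectedError (κ : ℝ) {n N : ℕ} (p : ℕ) {π : Measure (Fin N → ℝ)}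
    (hπ : IsIsotropic π) (X : Fin n → Fin N → ℝ) :
    tailSum κ p N ≤ expectedError κ p π X := by
  rw [expectedError_eq_sum κ p hπ X, tailSum,
    ← Fintype.sum_subtype_add_sum_subtype (fun j : Fin N => (j : ℕ) < p)]
  have h1 : ∀ k : {j : Fin N // ¬ (j : ℕ) < p},
      ∑ l, residualMatrix p (Matrix.of X) k l ^ 2 = 1 := by
    intro k
    simp [residualMatrix, k.2, Matrix.one_apply]
  simp_rw [h1, mul_one]
  refine le_add_of_nonneg_left (Finset.sum_nonneg fun j _ => ?_)
  have := (eigenvalue_pos κ j).le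
  positivity

/-- The expected error in terms of the standardized columns of the design. -/
lemma expectedError_designOfColumns (κ : ℝ) {n N : ℕ} {p : ℕ} (hp : p ≤ n)
    {π : Measure (Fin N → ℝ)} (hπ : IsIsotropic π) (z : Fin N → EuclideanSpace ℝ (Fin n))
    (hz : LinearIndependent ℝ fun a : {j : Fin N // (j : ℕ) < p} => z a) :
    expectedError κ p π (designOfColumns κ z) = tailSum κ p N +
      ∑ k : {j : Fin N // ¬ (j : ℕ) < p}, eigenvalue κ k *
        ∑ a : {j : Fin N // (j : ℕ) < p},
          inner ℝ (dualFamily (fun a : {j : Fin N // (j : ℕ) < p} => z a) a) (z k) ^ 2 := by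
  set X : Matrix (Fin n) (Fin N) ℝ := Matrix.of (designOfColumns κ z) with hX
  set g : {j : Fin N // (j : ℕ) < p} → EuclideanSpace ℝ (Fin n) := fun a => z a with hg
  set A := firstCols p X with hA
  have hc : ∀ j : ℕ, √(eigenvalue κ j) ≠ 0 := fun j => (Real.sqrt_pos.2 (eigenvalue_pos κ j)).ne'
  have hdet : (gram ℝ g).det ≠ 0 := det_gram_ne_zero_iff_linearIndependent.2 hz
  have hgram : Aᵀ * A = diagonal (fun a : {j : Fin N // (j : ℕ) < p} => √(eigenvalue κ a)) *
      gram ℝ g * diagonal (fun a : {j : Fin N // (j : ℕ) < p} => √(eigenvalue κ a)) := by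
    ext a b
    rw [mul_diagonal, diagonal_mul]
    simp [Matrix.mul_apply, hA, firstCols, hX, designOfColumns, hg, gram_apply,
      PiLp.inner_apply, Finset.mul_sum, Finset.sum_mul]
    exact Finset.sum_congr rfl fun i _ => by ring
  have hunit : IsUnit (Aᵀ * A).det := by
    rw [hgram, isUnit_iff_ne_zero]
    simp [Finset.prod_ne_zero_iff, hdet, hc]
  -- The candidate pseudoinverse: dual vectors of the standardized columns, rescaled. It is
  -- identified below through the normal equations `Aᵀ * A * M = Aᵀ`.
  set M : Matrix {j : Fin N // (j : ℕ) < p} (Fin n) ℝ :=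
    Matrix.of fun a i => (√(eigenvalue κ a))⁻¹ * dualFamily g a i with hM
  have hsel : selectedMatrix p X = M := by
    have hAM : Aᵀ * A * M = Aᵀ := by
      ext a i
      have h1 : (Aᵀ * A * M) a i =
          √(eigenvalue κ a) * ∑ b, gram ℝ g a b * dualFamily g b i := by
        rw [hgram, Matrix.mul_apply, Finset.mul_sum]
        refine Finset.sum_congr rfl fun b _ => ?_
        rw [mul_diagonal, diagonal_mul, hM, Matrix.of_apply]
        field_simp [hc b]
      have h2 := congrArg (fun v : EuclideanSpace ℝ (Fin n) => v i) (sum_gram_smul_dualFamily hz a)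
      simp only [WithLp.ofLp_sum, Finset.sum_apply, PiLp.smul_apply, smul_eq_mul] at h2
      rw [h1, h2]
      rfl
    rw [selectedMatrix, if_pos hp, ← hA]
    calc (Aᵀ * A)⁻¹ * Aᵀ = (Aᵀ * A)⁻¹ * (Aᵀ * A * M) := by rw [hAM]
      _ = M := by rw [← Matrix.mul_assoc, nonsing_inv_mul _ hunit, Matrix.one_mul]
  have hMX : ∀ (a : {j : Fin N // (j : ℕ) < p}) (k : Fin N), (M * X) a k =
      (√(eigenvalue κ a))⁻¹ * √(eigenvalue κ k) * inner ℝ (dualFamily g a) (z k) := by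
    intro a k
    simp [Matrix.mul_apply, hM, hX, designOfColumns, PiLp.inner_apply, Finset.mul_sum]
    exact Finset.sum_congr rfl fun i _ => by ring
  -- Duality makes the residual vanish on selected columns; on the others the weight `λ_a` cancels
  -- the squared factor `(√λ_a)⁻¹`.
  have hR : ∀ a : {j : Fin N // (j : ℕ) < p}, eigenvalue κ a * ∑ k, residualMatrix p X a k ^ 2 =
      ∑ k : {j : Fin N // ¬ (j : ℕ) < p}, eigenvalue κ k * inner ℝ (dualFamily g a) (z k) ^ 2 := by
    intro a
    have hR' : ∀ k, residualMatrix p X a k = (1 : Matrix (Fin N) (Fin N) ℝ) a k -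
        (√(eigenvalue κ a))⁻¹ * √(eigenvalue κ k) * inner ℝ (dualFamily g a) (z k) := by
      intro k
      simp only [residualMatrix, a.2, dif_pos, hsel, Subtype.coe_eta, hMX]
    rw [← Fintype.sum_subtype_add_sum_subtype (fun j : Fin N => (j : ℕ) < p),
      Finset.sum_eq_zero (fun k _ => ?_), zero_add, Finset.mul_sum]
    · refine Finset.sum_congr rfl fun k _ => ?_
      have hne : (a : Fin N) ≠ k := fun h => k.2 (h ▸ a.2)
      rw [hR', Matrix.one_apply_ne hne, zero_sub, neg_sq, mul_pow, mul_pow, inv_pow,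
        Real.sq_sqrt (eigenvalue_pos κ _).le, Real.sq_sqrt (eigenvalue_pos κ _).le]
      have := (eigenvalue_pos κ a).ne'
      field_simp
    · have := inner_dualFamily hz a k
      rw [hR', this]
      by_cases h : a = k
      · subst h
        simp [hc]
      · have h' : (a : Fin N) ≠ k := fun e => h (Subtype.ext e)
        rw [Matrix.one_apply_ne h, Matrix.one_apply_ne h']
        simp
  rw [expectedError_eq_sum κ p hπ, ← hX,
    ← Fintype.sum_subtype_add_sum_subtype (fun j : Fin N => (j : ℕ) < p), tailSum, add_comm]
  congr 1
  · refine Finset.sum_congr rfl fun k _ => ?_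
    simp [residualMatrix, k.2, Matrix.one_apply]
  · simp_rw [hR, Finset.mul_sum]
    exact Finset.sum_comm

end ErrorFormula

/-! ### The integral of `t ^ (-κ)`. -/

section PowerIntegral

/-- The integral of `t ^ (-κ)` over `[a, 1]`. -/
noncomputable def powerIntegral (κ a : ℝ) : ℝ := ∫ t in a..1, t ^ (-κ)

variable {κ : ℝ}

lemma intervalIntegrable_rpow_neg {a b : ℝ} (_ha : 0 ≤ a) (hb : 0 < b) (h : 0 < a ∨ κ < 1) :
    IntervalIntegrable (fun t : ℝ => t ^ (-κ)) volume a b := by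
  rcases h with h | h
  · exact intervalIntegral.intervalIntegrable_rpow (Or.inr (Set.notMem_uIcc_of_lt h hb))
  · exact intervalIntegral.intervalIntegrable_rpow' (by linarith)

lemma powerIntegral_eq_add {a b : ℝ} (ha : 0 ≤ a) (hb : 0 < b) (h : 0 < a ∨ κ < 1) :
    powerIntegral κ a = (∫ t in a..b, t ^ (-κ)) + powerIntegral κ b :=
  (intervalIntegral.integral_add_adjacent_intervals (intervalIntegrable_rpow_neg ha hb h)
    (intervalIntegrable_rpow_neg hb.le one_pos (Or.inl hb))).symm

/-- A decreasing integrand dominates its value at the right endpoint. This form allows `a = 0` when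
`κ < 1`. -/
lemma mul_rpow_neg_le_integral (hκ : 0 < κ) {a b : ℝ} (ha : 0 ≤ a) (hab : a < b)
    (h : 0 < a ∨ κ < 1) : (b - a) * b ^ (-κ) ≤ ∫ t in a..b, t ^ (-κ) := by
  have : ∫ _t in a..b, b ^ (-κ) = (b - a) * b ^ (-κ) := by simp
  rw [← this]
  refine intervalIntegral.integral_mono_on_of_le_Ioo hab.le (by simp)
    (intervalIntegrable_rpow_neg ha (ha.trans_lt hab) h) fun t ht => ?_
  exact Real.rpow_le_rpow_of_nonpos (ha.trans_lt ht.1) ht.2.le (by linarith)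

lemma integral_le_mul_rpow_neg (hκ : 0 < κ) {a b : ℝ} (ha : 0 < a) (hab : a ≤ b) :
    ∫ t in a..b, t ^ (-κ) ≤ (b - a) * a ^ (-κ) := by
  have : ∫ _t in a..b, a ^ (-κ) = (b - a) * a ^ (-κ) := by simp
  rw [← this]
  refine intervalIntegral.integral_mono_on_of_le_Ioo hab
    (intervalIntegrable_rpow_neg ha.le (ha.trans_le hab) (Or.inl ha)) (by simp) fun t ht => ?_
  exact Real.rpow_le_rpow_of_nonpos ha ht.1.le (by linarith)

lemma powerIntegral_pos (hκ : 0 < κ) {a : ℝ} (ha : 0 ≤ a) (ha1 : a < 1) (h : 0 < a ∨ κ < 1) :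
    0 < powerIntegral κ a := by
  have := mul_rpow_neg_le_integral hκ ha ha1 h
  rw [Real.one_rpow, mul_one] at this
  exact (sub_pos.2 ha1).trans_le this

lemma continuousAt_powerIntegral_of_pos {a : ℝ} (ha : 0 < a) :
    ContinuousAt (powerIntegral κ) a := by
  -- The interval is chosen to stay in the positive reals, to contain the base point `1` and to be a
  -- neighbourhood of `a`.
  have h1 : ContinuousOn (fun x => ∫ t in (1 : ℝ)..x, t ^ (-κ)) (Set.uIcc (min (a / 2) (1 / 2)) (a + 1)) :=
    intervalIntegral.continuousOn_primitive_interval'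
      (intervalIntegrable_rpow_neg (by positivity) (by positivity) (Or.inl (by positivity)))
      (by
        rw [Set.uIcc_of_le ((min_le_left _ _).trans (by linarith))]
        exact ⟨(min_le_right _ _).trans (by norm_num), by linarith⟩)
  rw [Set.uIcc_of_le ((min_le_left _ _).trans (by linarith))] at h1
  have h2 := (h1.continuousAt (Icc_mem_nhds ((min_le_left _ _).trans_lt (by linarith))
    (by linarith : a < a + 1))).neg
  refine h2.congr (Eventually.of_forall fun x => ?_)
  exact (intervalIntegral.integral_symm _ _).symm

lemma continuousAt_powerIntegral {a : ℝ} (h : 0 < a ∨ κ < 1) :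
    ContinuousAt (powerIntegral κ) a := by
  rcases h with h | h
  · exact continuousAt_powerIntegral_of_pos h
  · have h1 : Continuous fun x => ∫ t in (1 : ℝ)..x, t ^ (-κ) :=
      intervalIntegral.continuous_primitive
        (fun _ _ => intervalIntegral.intervalIntegrable_rpow' (by linarith)) 1
    refine h1.neg.continuousAt.congr (Eventually.of_forall fun x => ?_)
    exact (intervalIntegral.integral_symm _ _).symm

lemma lintegral_rpow_neg {a : ℝ} (ha : 0 ≤ a) (ha1 : a ≤ 1) (h : 0 < a ∨ κ < 1) :
    ∫⁻ t in Set.Ioc a 1, ENNReal.ofReal (t ^ (-κ)) = ENNReal.ofReal (powerIntegral κ a) := by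
  rw [powerIntegral, intervalIntegral.integral_of_le ha1, ofReal_integral_eq_lintegral_ofReal]
  · exact (intervalIntegrable_iff_integrableOn_Ioc_of_le ha1).1
      (intervalIntegrable_rpow_neg ha one_pos h)
  · filter_upwards [ae_restrict_mem measurableSet_Ioc] with t ht
    exact Real.rpow_nonneg (ha.trans ht.1.le) _

lemma lintegral_rpow_neg_eq_top (h : 1 ≤ κ) :
    ∫⁻ t in Set.Ioc (0 : ℝ) 1, ENNReal.ofReal (t ^ (-κ)) = ⊤ := by
  by_contra hne
  have h1 : IntegrableOn (fun t : ℝ => t ^ (-κ)) (Set.Ioc 0 1) := by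
    refine ⟨(by fun_prop : Measurable fun t : ℝ => t ^ (-κ)).aestronglyMeasurable, ?_⟩
    rw [hasFiniteIntegral_iff_ofReal]
    · exact lt_top_iff_ne_top.2 hne
    · filter_upwards [ae_restrict_mem measurableSet_Ioc] with t ht
      exact Real.rpow_nonneg ht.1.le _
  have h2 := (intervalIntegral.integrableOn_Ioo_rpow_iff (s := -κ) one_pos).1
    (h1.mono_set Set.Ioo_subset_Ioc_self)
  linarith

lemma asymptoticRisk_eq_ofReal (hκ : 0 < κ) {β : ℝ} (hβ1 : β < 1) (M : ℕ) {a : ℝ} (ha : 0 ≤ a)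
    (haβ : a < β) (h : 0 < a ∨ κ < 1) :
    asymptoticRisk κ β M a =
      ENNReal.ofReal ((M : ℝ) ^ (1 - κ) * powerIntegral κ a * (β / (β - a))) := by
  have h1 := (powerIntegral_pos hκ ha (haβ.trans hβ1) h).le
  rw [asymptoticRisk, lintegral_rpow_neg ha (haβ.trans hβ1).le h, ← ENNReal.ofReal_mul (by positivity),
    ← ENNReal.ofReal_mul (by positivity)]

lemma asymptoticRisk_zero_eq_top (h : 1 ≤ κ) {β : ℝ} (hβ : 0 < β) {M : ℕ} (hM : 0 < M) :
    asymptoticRisk κ β M 0 = ⊤ := by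
  have hM' : (0 : ℝ) < M := by exact_mod_cast hM
  rw [asymptoticRisk, lintegral_rpow_neg_eq_top h, ENNReal.mul_top, ENNReal.top_mul]
  · simp [hβ.ne']
  · simpa using Real.rpow_pos_of_pos hM' _

end PowerIntegral

/-! ### Monotonicity and minimum of the limiting risk. -/

section Shape

variable {κ β : ℝ}

/-- The function whose sign is the sign of the derivative of the asymptotic risk. -/
noncomputable def riskSlope (κ β a : ℝ) : ℝ := powerIntegral κ a - a ^ (-κ) * (β - a)

/-- The substitution `t ↦ a / t` explains `a^κ ∫_a^1 t^(-κ) dt = a ∫_a^1 t^(κ-2) dt`. It is checked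
on antiderivatives, apart from `κ = 1`, where both integrands are `t⁻¹`. -/
lemma mul_h_eq {a : ℝ} (ha : 0 < a) : a * h κ β a = -(a ^ κ * riskSlope κ β a) := by
  have h0 : (0 : ℝ) ∉ Set.uIcc a 1 := Set.notMem_uIcc_of_lt ha one_pos
  have hinv : a ^ κ * a ^ (-κ) = 1 := by
    rw [← Real.rpow_add ha]; simp
  have key : a ^ κ * powerIntegral κ a = a * ∫ t in a..1, t ^ (κ - 2) := by
    rcases eq_or_ne κ 1 with rfl | hne
    · rw [Real.rpow_one, powerIntegral]
      norm_num
    · have e1 : a ^ κ * a ^ (-κ + 1) = a := by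
        rw [← Real.rpow_add ha]; simp
      have e2 : a * a ^ (κ - 2 + 1) = a ^ κ := by
        nth_rewrite 1 [← Real.rpow_one a]
        rw [← Real.rpow_add ha]; ring_nf
      have n1 : -κ + 1 ≠ 0 := fun e => hne (by linarith)
      have n2 : κ - 2 + 1 ≠ 0 := fun e => hne (by linarith)
      rw [powerIntegral, integral_rpow (Or.inr ⟨fun e => hne (by linarith), h0⟩),
        integral_rpow (Or.inr ⟨fun e => hne (by linarith), h0⟩), Real.one_rpow, Real.one_rpow,
        mul_div_assoc', mul_div_assoc', mul_sub, mul_sub, e1, e2, div_eq_div_iff n1 n2]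
      ring
  have : a ^ κ * riskSlope κ β a = a ^ κ * powerIntegral κ a - (a ^ κ * a ^ (-κ)) * (β - a) := by
    rw [riskSlope]; ring
  rw [this, hinv, key, h]
  field_simp
  ring

lemma h_eq_zero_iff {a : ℝ} (ha : 0 < a) : h κ β a = 0 ↔ riskSlope κ β a = 0 := by
  have := mul_h_eq (κ := κ) (β := β) ha
  have h1 := Real.rpow_pos_of_pos ha κ
  constructor <;> intro h2 <;> rw [h2] at this
  · simpa [h1.ne'] using this
  · simpa [ha.ne'] using this

/-- From `a` to `b` the integral loses at most `(b - a) a^(-κ)`, while the subtracted term loses `(b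
- a) a^(-κ) + (a^(-κ) - b^(-κ)) (β - b)`, which is more. -/
lemma riskSlope_lt (hκ : 0 < κ) {a b : ℝ} (ha : 0 < a) (hab : a < b) (hb : b < β) :
    riskSlope κ β a < riskSlope κ β b := by
  have h1 := powerIntegral_eq_add (κ := κ) ha.le (ha.trans hab) (Or.inl ha)
  have h2 := integral_le_mul_rpow_neg hκ ha hab.le
  have h3 : b ^ (-κ) < a ^ (-κ) := Real.rpow_lt_rpow_of_neg ha hab (by linarith)
  unfold riskSlope
  nlinarith

lemma exists_riskSlope_eq_zero (hκ : 0 < κ) (hβ : 0 < β) (hβ1 : β < 1) :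
    ∃ a ∈ Set.Ioo 0 β, riskSlope κ β a = 0 := by
  -- Cutting the integral at `β / 4` bounds `a^κ I(a)` by `β / 4 + (a / (β / 4))^κ`. For small `a`
  -- this is below `β - a`, so the slope is negative for every `κ > 0`.
  have hlim : Tendsto (fun a : ℝ => a + (a / (β / 4)) ^ κ) (𝓝 0) (𝓝 (0 + (0 / (β / 4)) ^ κ)) := by
    have : ContinuousAt (fun a : ℝ => a + (a / (β / 4)) ^ κ) 0 :=
      continuousAt_id.add ((continuousAt_id.div_const _).rpow_const (Or.inr hκ.le))
    exact this
  rw [zero_div, Real.zero_rpow hκ.ne', add_zero] at hlim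
  have hev : ∀ᶠ a in 𝓝[>] (0 : ℝ), a + (a / (β / 4)) ^ κ < β / 2 :=
    (hlim.mono_left nhdsWithin_le_nhds).eventually (gt_mem_nhds (by positivity))
  obtain ⟨a, ha2, ha0, ha4⟩ := (hev.and (Ioo_mem_nhdsGT (by positivity : 0 < β / 4))).exists
  have hneg : riskSlope κ β a < 0 := by
    have h1 := powerIntegral_eq_add (κ := κ) ha0.le (by positivity : 0 < β / 4) (Or.inl ha0)
    have h2 := integral_le_mul_rpow_neg hκ ha0 ha4.le
    have h3 := integral_le_mul_rpow_neg hκ (by positivity : 0 < β / 4) (by linarith : β / 4 ≤ 1)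
    have h4 : 0 < a ^ κ := Real.rpow_pos_of_pos ha0 κ
    have h4' : a ^ κ * a ^ (-κ) = 1 := by rw [← Real.rpow_add ha0]; simp
    have h5 : a ^ κ * (β / 4) ^ (-κ) = (a / (β / 4)) ^ κ := by
      rw [Real.div_rpow ha0.le (by positivity), Real.rpow_neg (by positivity)]; rfl
    have h6 : 0 ≤ (a / (β / 4)) ^ κ := by positivity
    have h7 : a ^ κ * powerIntegral κ a ≤ (β / 4 - a) + (1 - β / 4) * (a / (β / 4)) ^ κ := by
      calc a ^ κ * powerIntegral κ a ≤
          a ^ κ * ((β / 4 - a) * a ^ (-κ) + (1 - β / 4) * (β / 4) ^ (-κ)) := by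
            gcongr
            rw [h1]
            exact add_le_add h2 h3
        _ = (β / 4 - a) * (a ^ κ * a ^ (-κ)) + (1 - β / 4) * (a ^ κ * (β / 4) ^ (-κ)) := by ring
        _ = _ := by rw [h4', h5]; ring
    have h8 : a ^ κ * riskSlope κ β a < 0 := by
      calc a ^ κ * riskSlope κ β a = a ^ κ * powerIntegral κ a - (a ^ κ * a ^ (-κ)) * (β - a) := by
            rw [riskSlope]; ring
        _ < 0 := by rw [h4']; nlinarith
    by_contra hge
    exact absurd (mul_nonneg h4.le (not_lt.1 hge)) (not_le.2 h8)
  have hpos : 0 < riskSlope κ β β := by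
    simpa [riskSlope] using powerIntegral_pos hκ hβ.le hβ1 (Or.inl hβ)
  have hcont : ContinuousOn (riskSlope κ β) (Set.Icc a β) := by
    intro x hx
    have hx0 : 0 < x := ha0.trans_le hx.1
    exact ((continuousAt_powerIntegral_of_pos hx0).sub
      ((Real.continuousAt_rpow_const x (-κ) (Or.inl hx0.ne')).mul
        (continuousAt_const.sub continuousAt_id))).continuousWithinAt
  obtain ⟨c, hc, hc0⟩ := intermediate_value_Ioo (by linarith) hcont ⟨hneg, hpos⟩
  exact ⟨c, ⟨ha0.trans hc.1, hc.2⟩, hc0⟩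

/-- A difference version of the derivative's sign. The slope enters only at the right endpoint, so
`a = 0` is allowed when `κ < 1`. -/
lemma powerIntegral_cross_right (hκ : 0 < κ) {a b : ℝ} (ha : 0 ≤ a) (hab : a < b) (hb : b < β)
    (h : 0 < a ∨ κ < 1) :
    -((b - a) * riskSlope κ β b) ≤
      powerIntegral κ a * (β - b) - powerIntegral κ b * (β - a) := by
  have h1 := powerIntegral_eq_add (κ := κ) ha (ha.trans_lt hab) h
  have h2 := mul_rpow_neg_le_integral hκ ha hab h
  unfold riskSlope
  nlinarith

lemma powerIntegral_cross_left (hκ : 0 < κ) {a b : ℝ} (ha : 0 < a) (hab : a < b) (hb : b < β) :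
    (b - a) * riskSlope κ β a ≤
      powerIntegral κ b * (β - a) - powerIntegral κ a * (β - b) := by
  have h1 := powerIntegral_eq_add (κ := κ) ha.le (ha.trans hab) (Or.inl ha)
  have h2 := integral_le_mul_rpow_neg hκ ha hab.le
  unfold riskSlope
  nlinarith

/-- The asymptotic risk as a function of the limiting ratio has a unique minimum, at the unique
zero of `h`. -/
lemma asymptoticRisk_shape (hκ : 0 < κ) (hβ : 0 < β) (hβ1 : β < 1) :
    ∃ a ∈ Set.Ioo 0 β, h κ β a = 0 ∧
      (∀ b ∈ Set.Ioo 0 β, h κ β b = 0 → b = a) ∧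
      ∀ M : ℕ, 0 < M →
        StrictAntiOn (asymptoticRisk κ β M) (Set.Ico 0 a) ∧
        StrictMonoOn (asymptoticRisk κ β M) (Set.Ioo a β) ∧
        IsLeast (asymptoticRisk κ β M '' Set.Ico 0 β) (asymptoticRisk κ β M a) ∧
        asymptoticRisk κ β M a = ENNReal.ofReal ((M : ℝ) ^ (1 - κ) * (β / a ^ κ)) := by
  obtain ⟨c, ⟨hc0, hcβ⟩, hc⟩ := exists_riskSlope_eq_zero hκ hβ hβ1
  have hdiv : ∀ a b : ℝ, a < β → b < β →
      powerIntegral κ a * (β - b) ≤ powerIntegral κ b * (β - a) →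
      powerIntegral κ a * (β / (β - a)) ≤ powerIntegral κ b * (β / (β - b)) := by
    intro a b ha hb h
    rw [mul_div_assoc', mul_div_assoc', div_le_div_iff₀ (by linarith) (by linarith)]
    nlinarith
  have hdiv' : ∀ a b : ℝ, a < β → b < β →
      powerIntegral κ a * (β - b) < powerIntegral κ b * (β - a) →
      powerIntegral κ a * (β / (β - a)) < powerIntegral κ b * (β / (β - b)) := by
    intro a b ha hb h
    rw [mul_div_assoc', mul_div_assoc', div_lt_div_iff₀ (by linarith) (by linarith)]
    nlinarith
  refine ⟨c, ⟨hc0, hcβ⟩, (h_eq_zero_iff hc0).2 hc, ?_, ?_⟩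
  · intro b ⟨hb0, hbβ⟩ hb
    rw [h_eq_zero_iff hb0] at hb
    rcases lt_trichotomy b c with h | h | h
    · exact absurd (riskSlope_lt hκ hb0 h hcβ) (by rw [hb, hc]; exact lt_irrefl _)
    · exact h
    · exact absurd (riskSlope_lt hκ hc0 h hbβ) (by rw [hb, hc]; exact lt_irrefl _)
  · intro M hM
    have hM' : (0 : ℝ) < (M : ℝ) ^ (1 - κ) := Real.rpow_pos_of_pos (by exact_mod_cast hM) _
    have hposR : ∀ a, 0 ≤ a → a < β → (0 < a ∨ κ < 1) →
        0 < (M : ℝ) ^ (1 - κ) * powerIntegral κ a * (β / (β - a)) := fun a ha haβ h =>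
      mul_pos (mul_pos hM' (powerIntegral_pos hκ ha (haβ.trans hβ1) h))
        (div_pos hβ (by linarith))
    refine ⟨?_, ?_, ⟨⟨c, ⟨hc0.le, hcβ⟩, rfl⟩, ?_⟩, ?_⟩
    · intro a ha b hb hab
      have hb0 : 0 < b := ha.1.trans_lt hab
      have hbβ : b < β := hb.2.trans hcβ
      have hs : riskSlope κ β b < 0 := hc ▸ riskSlope_lt hκ hb0 hb.2 hcβ
      rw [asymptoticRisk_eq_ofReal hκ hβ1 M hb0.le hbβ (Or.inl hb0)]
      by_cases h : 0 < a ∨ κ < 1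
      · rw [asymptoticRisk_eq_ofReal hκ hβ1 M ha.1 (hab.trans hbβ) h,
          ENNReal.ofReal_lt_ofReal_iff (hposR a ha.1 (hab.trans hbβ) h), mul_assoc, mul_assoc]
        have := powerIntegral_cross_right hκ ha.1 hab hbβ h
        exact mul_lt_mul_of_pos_left (hdiv' b a hbβ (hab.trans hbβ) (by nlinarith)) hM'
      -- Here `a = 0` and `κ ≥ 1`, where the risk is infinite.
      · rw [not_or, not_lt, not_lt] at h
        rw [le_antisymm h.1 ha.1, asymptoticRisk_zero_eq_top h.2 hβ hM]
        exact ENNReal.ofReal_lt_top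
    · intro a ha b hb hab
      have ha0 : 0 < a := hc0.trans ha.1
      have hs : 0 < riskSlope κ β a := hc ▸ riskSlope_lt hκ hc0 ha.1 ha.2
      rw [asymptoticRisk_eq_ofReal hκ hβ1 M ha0.le ha.2 (Or.inl ha0),
        asymptoticRisk_eq_ofReal hκ hβ1 M (ha0.trans hab).le hb.2 (Or.inl (ha0.trans hab)),
        ENNReal.ofReal_lt_ofReal_iff (hposR b (ha0.trans hab).le hb.2 (Or.inl (ha0.trans hab))),
        mul_assoc, mul_assoc]
      have := powerIntegral_cross_left hκ ha0 hab hb.2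
      exact mul_lt_mul_of_pos_left (hdiv' a b ha.2 hb.2 (by nlinarith)) hM'
    · rintro _ ⟨a, ⟨ha0, haβ⟩, rfl⟩
      by_cases h : 0 < a ∨ κ < 1
      · rw [asymptoticRisk_eq_ofReal hκ hβ1 M hc0.le hcβ (Or.inl hc0),
          asymptoticRisk_eq_ofReal hκ hβ1 M ha0 haβ h]
        refine ENNReal.ofReal_le_ofReal ?_
        rw [mul_assoc, mul_assoc]
        refine mul_le_mul_of_nonneg_left (hdiv c a hcβ haβ ?_) hM'.le
        rcases lt_trichotomy a c with h' | h' | h'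
        · have := powerIntegral_cross_right hκ ha0 h' hcβ h
          rw [hc] at this
          linarith
        · rw [h']
        · have := powerIntegral_cross_left hκ hc0 h' haβ
          rw [hc] at this
          linarith
      · rw [not_or, not_lt, not_lt] at h
        rw [le_antisymm h.1 ha0, asymptoticRisk_zero_eq_top h.2 hβ hM]
        exact le_top
    · rw [asymptoticRisk_eq_ofReal hκ hβ1 M hc0.le hcβ (Or.inl hc0)]
      congr 1
      have h1 : powerIntegral κ c = c ^ (-κ) * (β - c) := by
        have := hc
        unfold riskSlope at this
        linarith
      have h2 : β - c ≠ 0 := by linarith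
      have h3 := (Real.rpow_pos_of_pos hc0 κ).ne'
      rw [h1, Real.rpow_neg hc0.le]
      field_simp

end Shape

/-! ### Asymptotics of the sum of unselected eigenvalues. -/

section TailSum

variable {κ : ℝ}

lemma tailSum_eq_sum_Ico (κ : ℝ) (p N : ℕ) :
    tailSum κ p N = ∑ j ∈ Finset.Ico p N, ((j + 1 : ℕ) : ℝ) ^ (-κ) := by
  have h1 : tailSum κ p N = ∑ k : Fin N, if ¬ (k : ℕ) < p then eigenvalue κ k else 0 := by
    rw [← Finset.sum_filter, tailSum]
    exact (Finset.sum_subtype _ (by simp) (fun k : Fin N => eigenvalue κ k)).symm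
  rw [h1, Fin.sum_univ_eq_sum_range (fun k => if ¬ k < p then eigenvalue κ k else 0) N,
    ← Finset.sum_filter]
  refine Finset.sum_congr ?_ fun j _ => by simp [eigenvalue]
  ext j
  simp
  omega

lemma integral_rpow_neg_scale {N : ℝ} (hN : 0 < N) {a b : ℝ} (ha : 0 ≤ a) (hb : 0 ≤ b) :
    ∫ t in (N * a)..(N * b), t ^ (-κ) = N ^ (1 - κ) * ∫ t in a..b, t ^ (-κ) := by
  have h1 := intervalIntegral.mul_integral_comp_mul_left (a := a) (b := b)
    (f := fun t : ℝ => (t ^ (-κ) : ℝ)) N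
  rw [← h1, show (1 - κ) = 1 + -κ by ring, Real.rpow_add hN, Real.rpow_one, mul_assoc,
    ← intervalIntegral.integral_const_mul (N ^ (-κ))]
  refine congrArg (N * ·) (intervalIntegral.integral_congr fun t ht => ?_)
  have ht0 : 0 ≤ t := (le_min ha hb).trans ht.1
  exact Real.mul_rpow hN.le ht0

lemma antitoneOn_rpow_neg (hκ : 0 < κ) : AntitoneOn (fun t : ℝ => t ^ (-κ)) (Set.Ioi 0) :=
  fun _ hx _ _ hxy => Real.rpow_le_rpow_of_nonpos hx hxy (by linarith)

lemma tailSum_le (hκ : 0 < κ) {p N : ℕ} (hp : 0 < p) (hpN : p ≤ N) :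
    tailSum κ p N ≤ (N : ℝ) ^ (1 - κ) * powerIntegral κ (p / N) := by
  have hp' : (0 : ℝ) < p := by exact_mod_cast hp
  have hN : (0 : ℝ) < N := by exact_mod_cast hp.trans_le hpN
  have h1 := AntitoneOn.sum_le_integral_Ico hpN ((antitoneOn_rpow_neg hκ).mono
    (fun x hx => hp'.trans_le hx.1))
  rw [tailSum_eq_sum_Ico]
  refine h1.trans (le_of_eq ?_)
  rw [powerIntegral, ← integral_rpow_neg_scale hN (by positivity) zero_le_one]
  congr 1
  · field_simp
  · simp

/-- The sum dominates the integral of `t^(-κ)` over `[p + 1, N + 1]`. The shift by one keeps the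
interval away from `0`, and the excess over `[p + 1, N]` is negligible after scaling. -/
lemma le_tailSum (hκ : 0 < κ) {p N : ℕ} (hN : 0 < N) (hpN : p ≤ N) :
    (N : ℝ) ^ (1 - κ) * (powerIntegral κ ((p + 1) / N) - powerIntegral κ ((N + 1) / N)) ≤
      tailSum κ p N := by
  have hN' : (0 : ℝ) < N := by exact_mod_cast hN
  have h1 := AntitoneOn.integral_le_sum_Ico (Nat.add_le_add_right hpN 1)
    ((antitoneOn_rpow_neg hκ).mono
      (fun x (hx : x ∈ Set.Icc ((p + 1 : ℕ) : ℝ) ((N + 1 : ℕ) : ℝ)) =>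
        Set.mem_Ioi.2 (lt_of_lt_of_le (by positivity) hx.1)))
  rw [tailSum_eq_sum_Ico, Finset.sum_Ico_add' (fun j : ℕ => (j : ℝ) ^ (-κ))]
  refine le_trans (le_of_eq ?_) h1
  have hq : (0 : ℝ) < (p + 1) / N := by positivity
  have hr : (0 : ℝ) < (N + 1) / N := by positivity
  rw [powerIntegral_eq_add hq.le hr (Or.inl hq), add_sub_cancel_right,
    ← integral_rpow_neg_scale hN' hq.le hr.le]
  congr 1 <;> push_cast <;> field_simp

variable {p N : ℕ → ℕ} {α : ℝ}

lemma tendsto_succ_div (hN : Tendsto N atTop atTop)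
    (hpN : Tendsto (fun k => (p k : ℝ) / (N k : ℝ)) atTop (𝓝 α)) :
    Tendsto (fun k => ((p k : ℝ) + 1) / (N k : ℝ)) atTop (𝓝 α) := by
  have h1 : Tendsto (fun k => 1 / (N k : ℝ)) atTop (𝓝 0) :=
    tendsto_one_div_atTop_nhds_zero_nat.comp hN
  simpa [add_div] using hpN.add h1

lemma tendsto_succ_div_self (hN : Tendsto N atTop atTop) :
    Tendsto (fun k => ((N k : ℝ) + 1) / (N k : ℝ)) atTop (𝓝 1) := by
  refine tendsto_succ_div hN (tendsto_const_nhds.congr' ?_)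
  filter_upwards [hN.eventually_gt_atTop 0] with k hk
  have : (N k : ℝ) ≠ 0 := by exact_mod_cast hk.ne'
  rw [div_self this]

lemma eventually_lt_of_ratio (hα1 : α < 1) (hN : Tendsto N atTop atTop)
    (hpN : Tendsto (fun k => (p k : ℝ) / (N k : ℝ)) atTop (𝓝 α)) :
    ∀ᶠ k in atTop, p k < N k := by
  filter_upwards [hpN.eventually (gt_mem_nhds hα1), hN.eventually_gt_atTop 0] with k h1 h2
  have : (0 : ℝ) < N k := by exact_mod_cast h2
  rw [div_lt_one this] at h1
  exact_mod_cast h1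

lemma tendsto_tailSum_div (hκ : 0 < κ) (hα1 : α < 1) (h : 0 < α ∨ κ < 1)
    (hp : Tendsto p atTop atTop) (hN : Tendsto N atTop atTop)
    (hpN : Tendsto (fun k => (p k : ℝ) / (N k : ℝ)) atTop (𝓝 α)) :
    Tendsto (fun k => tailSum κ (p k) (N k) / (N k : ℝ) ^ (1 - κ)) atTop
      (𝓝 (powerIntegral κ α)) := by
  have hc := continuousAt_powerIntegral (κ := κ) h
  have hlow : Tendsto (fun k => powerIntegral κ (((p k : ℝ) + 1) / N k) -
      powerIntegral κ (((N k : ℝ) + 1) / N k)) atTop (𝓝 (powerIntegral κ α - powerIntegral κ 1)) :=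
    (hc.tendsto.comp (tendsto_succ_div hN hpN)).sub
      ((continuousAt_powerIntegral_of_pos one_pos).tendsto.comp (tendsto_succ_div_self hN))
  have h1 : powerIntegral κ 1 = 0 := by simp [powerIntegral]
  rw [h1, sub_zero] at hlow
  refine tendsto_of_tendsto_of_tendsto_of_le_of_le' hlow (hc.tendsto.comp hpN) ?_ ?_
  all_goals
    filter_upwards [hp.eventually_gt_atTop 0, eventually_lt_of_ratio hα1 hN hpN] with k h2 h3
    have hN0 : 0 < N k := h2.trans h3
    have : (0 : ℝ) < (N k : ℝ) ^ (1 - κ) := Real.rpow_pos_of_pos (by exact_mod_cast hN0) _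
  · rw [le_div_iff₀ this, mul_comm]
    exact le_tailSum hκ hN0 h3.le
  · rw [div_le_iff₀ this, mul_comm]
    exact tailSum_le hκ h2 h3.le

/-- For `κ ≥ 1` one has `t^(-κ) ≥ t⁻¹` on `(0, 1]`, so the scaled sum is at least `-log ((p + 1) /
N)`. -/
lemma tendsto_tailSum_atTop (hκ : 1 ≤ κ) (hN : Tendsto N atTop atTop)
    (hpN : Tendsto (fun k => (p k : ℝ) / (N k : ℝ)) atTop (𝓝 0)) :
    Tendsto (fun k => (N k : ℝ) ^ (κ - 1) * tailSum κ (p k) (N k)) atTop atTop := by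
  have h1 : Tendsto (fun k => ((p k : ℝ) + 1) / (N k : ℝ)) atTop (𝓝[>] 0) := by
    refine tendsto_nhdsWithin_iff.2 ⟨tendsto_succ_div hN hpN, ?_⟩
    filter_upwards [hN.eventually_gt_atTop 0] with k hk
    have : (0 : ℝ) < N k := by exact_mod_cast hk
    exact div_pos (by positivity) this
  have h2 := tendsto_neg_atBot_atTop.comp (Real.tendsto_log_nhdsGT_zero.comp h1)
  refine tendsto_atTop_mono' _ ?_ h2
  filter_upwards [hN.eventually_gt_atTop 0, eventually_lt_of_ratio one_pos hN hpN] with k hk hlt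
  have hN' : (0 : ℝ) < N k := by exact_mod_cast hk
  have hle := le_tailSum (by linarith : 0 < κ) hk hlt.le
  have hq : 0 < ((p k : ℝ) + 1) / N k := by positivity
  have hq1 : ((p k : ℝ) + 1) / N k ≤ 1 := by
    rw [div_le_one hN']; exact_mod_cast hlt
  have hr : powerIntegral κ (((N k : ℝ) + 1) / N k) ≤ 0 := by
    rw [powerIntegral, intervalIntegral.integral_symm]
    have : (1 : ℝ) ≤ ((N k : ℝ) + 1) / N k := by rw [le_div_iff₀ hN']; linarith
    refine neg_nonpos.2 (intervalIntegral.integral_nonneg this fun t ht => ?_)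
    exact Real.rpow_nonneg (zero_le_one.trans ht.1) _
  have hlog : -Real.log (((p k : ℝ) + 1) / N k) ≤ powerIntegral κ (((p k : ℝ) + 1) / N k) := by
    have : ∫ t in (((p k : ℝ) + 1) / N k)..1, t⁻¹ = -Real.log (((p k : ℝ) + 1) / N k) := by
      rw [integral_inv_of_pos hq one_pos, one_div, Real.log_inv]
    rw [← this]
    refine intervalIntegral.integral_mono_on hq1 ?_
      (intervalIntegrable_rpow_neg hq.le one_pos (Or.inl hq)) fun t ht => ?_
    · exact intervalIntegrable_inv_iff.2 (Or.inr (Set.notMem_uIcc_of_lt hq one_pos))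
    · rw [← Real.rpow_neg_one]
      exact Real.rpow_le_rpow_of_exponent_ge (hq.trans_le ht.1) ht.2 (by linarith)
  have hmul : (N k : ℝ) ^ (κ - 1) * (N k : ℝ) ^ (1 - κ) = 1 := by
    rw [← Real.rpow_add hN']; simp
  calc -Real.log (((p k : ℝ) + 1) / N k) ≤
      powerIntegral κ (((p k : ℝ) + 1) / N k) - powerIntegral κ (((N k : ℝ) + 1) / N k) := by
        linarith
    _ = (N k : ℝ) ^ (κ - 1) * ((N k : ℝ) ^ (1 - κ) * (powerIntegral κ (((p k : ℝ) + 1) / N k) -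
        powerIntegral κ (((N k : ℝ) + 1) / N k))) := by rw [← mul_assoc, hmul, one_mul]
    _ ≤ _ := by gcongr

lemma sum_sq_eigenvalue_le (hκ : 0 < κ) (p N : ℕ) :
    ∑ k : {j : Fin N // ¬ (j : ℕ) < p}, eigenvalue κ k ^ 2 ≤ ((p : ℝ) + 1) ^ (-κ) * tailSum κ p N := by
  rw [tailSum, Finset.mul_sum]
  refine Finset.sum_le_sum fun k _ => ?_
  rw [sq]
  refine mul_le_mul_of_nonneg_right ?_ (eigenvalue_pos κ _).le
  have : p ≤ (k : Fin N) := not_lt.1 k.2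
  exact Real.rpow_le_rpow_of_nonpos (by positivity) (by gcongr) (by linarith)

/-- No single unselected eigenvalue dominates, as Chebyshev's inequality requires. If `α > 0`, the
largest is of order `N^(-κ)` against `N^(1-κ)`; if `κ < 1`, it is at most `1` while `N^(1-κ)`
diverges. -/
lemma tendsto_max_div_tailSum (hκ : 0 < κ) (hα0 : 0 ≤ α) (hα1 : α < 1) (h : 0 < α ∨ κ < 1)
    (hp : Tendsto p atTop atTop) (hN : Tendsto N atTop atTop)
    (hpN : Tendsto (fun k => (p k : ℝ) / (N k : ℝ)) atTop (𝓝 α)) :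
    Tendsto (fun k => ((p k : ℝ) + 1) ^ (-κ) / tailSum κ (p k) (N k)) atTop (𝓝 0) := by
  have hNr : Tendsto (fun k => (N k : ℝ)) atTop atTop := tendsto_natCast_atTop_atTop.comp hN
  have hnum : Tendsto (fun k => ((p k : ℝ) + 1) ^ (-κ) / (N k : ℝ) ^ (1 - κ)) atTop (𝓝 0) := by
    rcases h with h | h
    · have h1 : Tendsto (fun k => (((p k : ℝ) + 1) / N k) ^ (-κ) * (N k : ℝ)⁻¹) atTop
          (𝓝 (α ^ (-κ) * 0)) :=
        ((tendsto_succ_div hN hpN).rpow_const (Or.inl h.ne')).mul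
          (tendsto_inv_atTop_zero.comp hNr)
      rw [mul_zero] at h1
      refine h1.congr' ?_
      filter_upwards [hN.eventually_gt_atTop 0] with k hk
      have hN' : (0 : ℝ) < N k := by exact_mod_cast hk
      rw [Real.div_rpow (by positivity) hN'.le, show 1 - κ = -κ + 1 by ring, Real.rpow_add hN',
        Real.rpow_one]
      field_simp
    · have h1 : Tendsto (fun k => (N k : ℝ) ^ (-(1 - κ))) atTop (𝓝 0) :=
        (tendsto_rpow_neg_atTop (by linarith)).comp hNr
      refine squeeze_zero (fun k => by positivity) (fun k => ?_) h1
      rw [Real.rpow_neg (Nat.cast_nonneg (N k)), div_eq_mul_inv]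
      have h2 : ((p k : ℝ) + 1) ^ (-κ) ≤ 1 :=
        Real.rpow_le_one_of_one_le_of_nonpos (by simp) (by linarith)
      exact mul_le_of_le_one_left (inv_nonneg.2 (Real.rpow_nonneg (Nat.cast_nonneg _) _)) h2
  have h2 := hnum.div (tendsto_tailSum_div hκ hα1 h hp hN hpN)
    (powerIntegral_pos hκ hα0 hα1 h).ne'
  rw [zero_div] at h2
  refine h2.congr' ?_
  filter_upwards [hN.eventually_gt_atTop 0] with k hk
  have : (0 : ℝ) < (N k : ℝ) ^ (1 - κ) := Real.rpow_pos_of_pos (by exact_mod_cast hk) _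
  simp only [Pi.div_apply]
  rw [div_div_div_cancel_right₀ this.ne']

end TailSum

/-! ### Convergence in probability of the expected error. -/

section Assembly

/-- The bijection between designs and their standardized columns. -/
noncomputable def designEquiv (κ : ℝ) (n N : ℕ) :
    (Fin N → EuclideanSpace ℝ (Fin n)) ≃ᵐ (Fin n → Fin N → ℝ) where
  toFun := designOfColumns κ
  invFun X := fun j : Fin N => WithLp.toLp 2 fun i => (√(eigenvalue κ j))⁻¹ * X i j
  left_inv z := by
    ext j i
    have : √(eigenvalue κ j) ≠ 0 := (Real.sqrt_pos.2 (eigenvalue_pos κ j)).ne'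
    simp [designOfColumns, this]
  right_inv X := by
    ext i j
    have : √(eigenvalue κ j) ≠ 0 := (Real.sqrt_pos.2 (eigenvalue_pos κ j)).ne'
    simp [designOfColumns, this]
  measurable_toFun := measurable_designOfColumns κ
  measurable_invFun := by
    change Measurable fun X : Fin n → Fin N → ℝ =>
      fun j : Fin N => WithLp.toLp 2 fun i : Fin n => (√(eigenvalue κ j))⁻¹ * X i j
    fun_prop

/-- Since standardization is a measurable equivalence, `s` can be arbitrary, and no measurability of
`expectedError` is needed. -/
lemma designLaw_apply (κ : ℝ) (n N : ℕ) (s : Set (Fin n → Fin N → ℝ)) :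
    designLaw κ n N s = (Measure.pi fun _ : Fin N => stdGaussian (EuclideanSpace ℝ (Fin n)))
      {z | designOfColumns κ z ∈ s} := by
  rw [designLaw_eq_map]
  exact (designEquiv κ n N).map_apply s

lemma sum_norm_sq_dualFamily {E ι : Type*} [NormedAddCommGroup E] [InnerProductSpace ℝ E]
    [Fintype ι] [DecidableEq ι] {g : ι → E} (hg : LinearIndependent ℝ g) :
    ∑ a, ‖dualFamily g a‖ ^ 2 = (gram ℝ g)⁻¹.trace := by
  refine Finset.sum_congr rfl fun a _ => ?_
  rw [← real_inner_self_eq_norm_sq, inner_dualFamily_dualFamily hg, Matrix.diag_apply]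

lemma measurable_dualFamily {E ι : Type*} [NormedAddCommGroup E] [InnerProductSpace ℝ E]
    [FiniteDimensional ℝ E] [MeasurableSpace E] [BorelSpace E]
    [Fintype ι] [DecidableEq ι] (a : ι) : Measurable fun g : ι → E => dualFamily g a :=
  Finset.measurable_fun_sum _ fun b _ => (measurable_inv_gram a b).smul (measurable_pi_apply b)

/-- The expected error of an underparametrized regression concentrates. -/
lemma designLaw_expectedError_deviation_le {κ : ℝ} (hκ : 0 < κ) {n N p : ℕ} (hpn : p ≤ n)
    (hpN : p < N) {π : Measure (Fin N → ℝ)} (hπ : IsIsotropic π)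
    {ε η : ℝ} (hε : 0 < ε) (hε1 : ε < 1) (hη : 0 < η) :
    designLaw κ n N {X | ¬ (tailSum κ p N *
          (1 + (p : ℝ) / (n - p + 1 : ℕ) * (1 + ε)⁻¹ - η) ≤ expectedError κ p π X ∧
        expectedError κ p π X ≤ tailSum κ p N *
          (1 + (p : ℝ) / (n - p + 1 : ℕ) * (1 - ε)⁻¹ + η))} ≤
      p * ENNReal.ofReal (3 * (∫ x : ℝ, (x ^ 2 - 1) ^ 4 ∂gaussianReal 0 1) /
        (ε ^ 4 * ((n - p + 1 : ℕ) : ℝ) ^ 2)) +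
      ENNReal.ofReal ((∫ x : ℝ, x ^ 4 ∂gaussianReal 0 1) *
        (((p : ℝ) + 1) ^ (-κ) / tailSum κ p N) *
        ((p : ℝ) / (n - p + 1 : ℕ) * (1 - ε)⁻¹) ^ 2 / η ^ 2) := by
  set m : ℕ := n - p + 1 with hm
  set S := tailSum κ p N with hS
  have hS0 : 0 < S := by
    refine Finset.sum_pos (fun _ _ => eigenvalue_pos κ _) ⟨⟨⟨p, hpN⟩, ?_⟩, Finset.mem_univ _⟩
    simp
  set E := EuclideanSpace ℝ (Fin n) with hE
  set μP := Measure.pi fun _ : {j : Fin N // (j : ℕ) < p} => stdGaussian E with hμP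
  set μC := Measure.pi fun _ : {j : Fin N // ¬ (j : ℕ) < p} => stdGaussian E with hμC
  set τ := (p : ℝ) / m * (1 - ε)⁻¹ with hτ
  have hcardP : Fintype.card {j : Fin N // (j : ℕ) < p} = p := by
    rw [Fintype.card_subtype, Fin.card_filter_val_lt]
    omega
  set K4 := ∫ x : ℝ, x ^ 4 ∂gaussianReal 0 1
  have hK4 : 0 ≤ K4 := integral_nonneg fun x => by positivity
  set Bad : Set ({j : Fin N // (j : ℕ) < p} → E) := {g | ¬ (LinearIndependent ℝ g ∧
        (p : ℝ) / m * (1 + ε)⁻¹ ≤ (gram ℝ g)⁻¹.trace ∧ (gram ℝ g)⁻¹.trace ≤ τ)} with hBad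
  have hBadle : μP Bad ≤ p * ENNReal.ofReal (3 * (∫ x : ℝ, (x ^ 2 - 1) ^ 4 ∂gaussianReal 0 1) /
        (ε ^ 4 * (m : ℝ) ^ 2)) := by
    have h := measure_trace_inv_gram_deviation_le (E := E)
      (ι := {j : Fin N // (j : ℕ) < p}) (m := m) (by omega)
      (by
        have : Module.finrank ℝ E = n := finrank_euclideanSpace_fin
        rw [hcardP]
        omega) hε hε1
    rwa [hcardP] at h
  -- The trace bound is built into `Q`: a slice over a `g` that violates it is empty, so the
  -- conditional Chebyshev bound is uniform in `g`.
  set Q : Set (({j : Fin N // (j : ℕ) < p} → E) × ({j : Fin N // ¬ (j : ℕ) < p} → E)) :=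
    {x | ∑ a, ‖dualFamily x.1 a‖ ^ 2 ≤ τ ∧ η * S ≤ |∑ k : {j : Fin N // ¬ (j : ℕ) < p},
        eigenvalue κ k * ∑ a, inner ℝ (dualFamily x.1 a) (x.2 k) ^ 2 -
        S * ∑ a, ‖dualFamily x.1 a‖ ^ 2|} with hQ
  have hQm : MeasurableSet Q := by
    have h1 : ∀ a, Measurable fun x : ({j : Fin N // (j : ℕ) < p} → E) ×
        ({j : Fin N // ¬ (j : ℕ) < p} → E) => dualFamily x.1 a := fun a =>
      (measurable_dualFamily a).comp measurable_fst
    have h2 : Measurable fun x : ({j : Fin N // (j : ℕ) < p} → E) ×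
        ({j : Fin N // ¬ (j : ℕ) < p} → E) => ∑ a, ‖dualFamily x.1 a‖ ^ 2 :=
      Finset.measurable_fun_sum _ fun a _ => (h1 a).norm.pow_const 2
    refine (measurableSet_le h2 measurable_const).inter
      (measurableSet_le measurable_const (Measurable.abs (Measurable.sub ?_ (h2.const_mul S))))
    refine Finset.measurable_fun_sum _ fun k _ => Measurable.const_mul
      (Finset.measurable_fun_sum _ fun a _ => Measurable.pow_const ?_ 2) _
    exact (h1 a).inner ((measurable_pi_apply k).comp measurable_snd)
  have hQle : (μP.prod μC) Q ≤ ENNReal.ofReal (K4 * (((p : ℝ) + 1) ^ (-κ) / S) * τ ^ 2 / η ^ 2) := by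
    rw [Measure.prod_apply hQm]
    refine (lintegral_mono (g := fun _ => ENNReal.ofReal
      (K4 * (((p : ℝ) + 1) ^ (-κ) / S) * τ ^ 2 / η ^ 2)) fun g => ?_).trans (by simp)
    by_cases hg : ∑ a, ‖dualFamily g a‖ ^ 2 ≤ τ
    · have h := measure_quadraticForm_deviation_le (dualFamily g)
        (fun k : {j : Fin N // ¬ (j : ℕ) < p} => eigenvalue κ k) (mul_pos hη hS0)
      refine (measure_mono fun w hw => hw.2).trans (h.trans (ENNReal.ofReal_le_ofReal ?_))
      calc _ ≤ K4 * (((p : ℝ) + 1) ^ (-κ) * S) * τ ^ 2 / (η * S) ^ 2 := by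
            gcongr
            exact sum_sq_eigenvalue_le hκ p N
        _ = _ := by field_simp
    · have : Prod.mk g ⁻¹' Q = ∅ := by
        ext w
        simp [hQ, hg]
      rw [this]
      simp
  rw [designLaw_apply]
  have hmp := measurePreserving_piEquivPiSubtypeProd (fun _ : Fin N => stdGaussian E)
    (fun j => (j : ℕ) < p)
  calc _ ≤ (Measure.pi fun _ : Fin N => stdGaussian E)
        (MeasurableEquiv.piEquivPiSubtypeProd (fun _ => E) (fun j : Fin N => (j : ℕ) < p) ⁻¹'
          (Bad ×ˢ Set.univ ∪ Q)) := by
        refine measure_mono fun z hz => ?_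
        by_contra hcon
        apply hz
        rw [Set.mem_preimage, Set.mem_union, not_or] at hcon
        obtain ⟨hb, hq⟩ := hcon
        have hb' : LinearIndependent ℝ (fun a : {j : Fin N // (j : ℕ) < p} => z a) ∧
            (p : ℝ) / m * (1 + ε)⁻¹ ≤
              (gram ℝ (fun a : {j : Fin N // (j : ℕ) < p} => z a))⁻¹.trace ∧
            (gram ℝ (fun a : {j : Fin N // (j : ℕ) < p} => z a))⁻¹.trace ≤ τ := by
          by_contra h
          exact hb ⟨h, trivial⟩
        obtain ⟨hli, hlo, hhi⟩ := hb'
        rw [← sum_norm_sq_dualFamily hli] at hlo hhi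
        have hq' : |_| < η * S := not_le.1 fun h => hq ⟨hhi, h⟩
        rw [expectedError_designOfColumns κ hpn hπ z hli]
        obtain ⟨h1, h2⟩ := abs_lt.1 hq'
        simp only [MeasurableEquiv.piEquivPiSubtypeProd, Equiv.piEquivPiSubtypeProd,
          MeasurableEquiv.coe_mk, Equiv.coe_fn_mk] at h1 h2
        have h3 := mul_le_mul_of_nonneg_left hlo hS0.le
        have h4 := mul_le_mul_of_nonneg_left hhi hS0.le
        constructor <;> linarith
    _ = (μP.prod μC) (Bad ×ˢ Set.univ ∪ Q) := hmp.measure_preimage_equiv _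
    _ ≤ (μP.prod μC) (Bad ×ˢ Set.univ) + (μP.prod μC) Q := measure_union_le _ _
    _ ≤ _ := by
        refine add_le_add ?_ hQle
        rw [Measure.prod_prod, measure_univ, mul_one]
        exact hBadle

variable {p n N : ℕ → ℕ} {α β : ℝ}

lemma tendsto_ratio_residual (hαβ : α < β) (hpn : ∀ᶠ k in atTop, p k < n k)
    (hN : Tendsto N atTop atTop)
    (hpN : Tendsto (fun k => (p k : ℝ) / (N k : ℝ)) atTop (𝓝 α))
    (hnN : Tendsto (fun k => (n k : ℝ) / (N k : ℝ)) atTop (𝓝 β)) :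
    Tendsto (fun k => (p k : ℝ) / ((n k - p k + 1 : ℕ) : ℝ)) atTop (𝓝 (α / (β - α))) ∧
    Tendsto (fun k => ((n k - p k + 1 : ℕ) : ℝ)) atTop atTop := by
  have h1 : Tendsto (fun k => ((n k : ℝ) + 1) / N k - (p k : ℝ) / N k) atTop (𝓝 (β - α)) :=
    (tendsto_succ_div hN hnN).sub hpN
  have h2 : Tendsto (fun k => ((n k - p k + 1 : ℕ) : ℝ) / N k) atTop (𝓝 (β - α)) := by
    refine h1.congr' ?_
    filter_upwards [hpn] with k hk
    rw [← sub_div]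
    push_cast [Nat.cast_sub hk.le]
    ring
  have hN0 : ∀ᶠ k in atTop, (N k : ℝ) ≠ 0 := by
    filter_upwards [hN.eventually_gt_atTop 0] with k hk
    exact_mod_cast hk.ne'
  constructor
  · refine (hpN.div h2 (sub_pos.2 hαβ).ne').congr' ?_
    filter_upwards [hN0] with k hk
    exact div_div_div_cancel_right₀ hk _ _
  · refine ((tendsto_natCast_atTop_atTop.comp hN).atTop_mul_pos (sub_pos.2 hαβ) h2).congr' ?_
    filter_upwards [hN0] with k hk
    simp only [Function.comp_apply]
    field_simp

lemma eventually_lt_of_ratio_lt (hαβ : α < β) (hN : Tendsto N atTop atTop)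
    (hpN : Tendsto (fun k => (p k : ℝ) / (N k : ℝ)) atTop (𝓝 α))
    (hnN : Tendsto (fun k => (n k : ℝ) / (N k : ℝ)) atTop (𝓝 β)) :
    ∀ᶠ k in atTop, p k < n k := by
  filter_upwards [hpN.eventually_lt hnN hαβ, hN.eventually_gt_atTop 0] with k h1 h2
  have : (0 : ℝ) < N k := by exact_mod_cast h2
  rw [div_lt_div_iff_of_pos_right this] at h1
  exact_mod_cast h1

lemma tendstoInProb_expectedError {κ : ℝ} (hκ : 0 < κ) (hα : 0 ≤ α) (hβ : β < 1) (hαβ : α < β)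
    (h : 0 < α ∨ κ < 1) (hp : Tendsto p atTop atTop) (hN : Tendsto N atTop atTop)
    (hpN : Tendsto (fun k => (p k : ℝ) / (N k : ℝ)) atTop (𝓝 α))
    (hnN : Tendsto (fun k => (n k : ℝ) / (N k : ℝ)) atTop (𝓝 β))
    (π : ∀ k, Measure (Fin (N k) → ℝ)) (hπ : ∀ k, IsIsotropic (π k)) :
    TendstoInProb (fun k => designLaw κ (n k) (N k))
      (fun k X => expectedError κ (p k) (π k) X)
      (fun k => (asymptoticRisk κ β (N k) α).toReal) := by
  intro ε₀ hε₀
  have hα1 : α < 1 := hαβ.trans hβ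
  have hβ0 : 0 < β := hα.trans_lt hαβ
  have hpn := eventually_lt_of_ratio_lt hαβ hN hpN hnN
  obtain ⟨hr, hm⟩ := tendsto_ratio_residual hαβ hpn hN hpN hnN
  set m : ℕ → ℕ := fun k => n k - p k + 1 with hmdef
  set c := α / (β - α) with hc
  have hβα : 0 < β - α := sub_pos.2 hαβ
  have hc1 : 0 < 1 + c := by positivity
  have hI := powerIntegral_pos hκ hα hα1 h
  have hY : ∀ k, (asymptoticRisk κ β (N k) α).toReal =
      (N k : ℝ) ^ (1 - κ) * powerIntegral κ α * (1 + c) := by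
    intro k
    rw [asymptoticRisk_eq_ofReal hκ hβ (N k) hα hαβ h, ENNReal.toReal_ofReal (by positivity)]
    congr 1
    rw [hc]
    field_simp
    ring
  have hSY : Tendsto (fun k => tailSum κ (p k) (N k) /
      ((N k : ℝ) ^ (1 - κ) * powerIntegral κ α * (1 + c))) atTop (𝓝 (1 + c)⁻¹) := by
    have h1 := ((tendsto_tailSum_div hκ hα1 h hp hN hpN).div_const (powerIntegral κ α)).div_const
      (1 + c)
    rw [div_self hI.ne', one_div] at h1
    refine h1.congr fun k => ?_
    rw [div_div, div_div, mul_assoc]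
  -- One small `s` serves as tolerance both for the trace and for the quadratic form; at `s = 0`
  -- both expressions equal `1`.
  obtain ⟨s, hsu, hsl, hs0, hs1⟩ : ∃ s : ℝ, (1 + c)⁻¹ * (1 + c * (1 - s)⁻¹ + s) < 1 + ε₀ ∧
      1 - ε₀ < (1 + c)⁻¹ * (1 + c * (1 + s)⁻¹ - s) ∧ 0 < s ∧ s < 1 := by
    have hu : ContinuousAt (fun s : ℝ => (1 + c)⁻¹ * (1 + c * (1 - s)⁻¹ + s)) 0 := by
      have : ContinuousAt (fun s : ℝ => (1 - s)⁻¹) 0 :=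
        (continuousAt_const.sub continuousAt_id).inv₀ (by simp)
      fun_prop
    have hl : ContinuousAt (fun s : ℝ => (1 + c)⁻¹ * (1 + c * (1 + s)⁻¹ - s)) 0 := by
      have : ContinuousAt (fun s : ℝ => (1 + s)⁻¹) 0 :=
        (continuousAt_const.add continuousAt_id).inv₀ (by simp)
      fun_prop
    have eu : ∀ᶠ s in 𝓝 (0 : ℝ), (1 + c)⁻¹ * (1 + c * (1 - s)⁻¹ + s) < 1 + ε₀ :=
      hu.eventually_lt continuousAt_const (by simp [hc1.ne', hε₀])
    have el : ∀ᶠ s in 𝓝 (0 : ℝ), 1 - ε₀ < (1 + c)⁻¹ * (1 + c * (1 + s)⁻¹ - s) :=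
      continuousAt_const.eventually_lt hl (by simp [hc1.ne', hε₀])
    obtain ⟨s, hs, hs01⟩ := ((eu.and el).filter_mono
      (nhdsWithin_le_nhds (s := Set.Ioi 0))).and (Ioo_mem_nhdsGT one_pos) |>.exists
    exact ⟨s, hs.1, hs.2, hs01⟩
  have hup := (hSY.mul ((tendsto_const_nhds (x := (1 : ℝ))).add
    (hr.mul_const (1 - s)⁻¹) |>.add_const s)).eventually (gt_mem_nhds hsu)
  have hlow := (hSY.mul ((tendsto_const_nhds (x := (1 : ℝ))).add
    (hr.mul_const (1 + s)⁻¹) |>.sub_const s)).eventually (lt_mem_nhds hsl)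
  set K8 := ∫ x : ℝ, (x ^ 2 - 1) ^ 4 ∂gaussianReal 0 1
  set K4 := ∫ x : ℝ, x ^ 4 ∂gaussianReal 0 1
  have hlim : Tendsto (fun k => (p k : ℝ≥0∞) * ENNReal.ofReal (3 * K8 / (s ^ 4 * (m k : ℝ) ^ 2)) +
      ENNReal.ofReal (K4 * (((p k : ℝ) + 1) ^ (-κ) / tailSum κ (p k) (N k)) *
        ((p k : ℝ) / (m k : ℝ) * (1 - s)⁻¹) ^ 2 / s ^ 2)) atTop (𝓝 0) := by
    -- The union bound `p * O(1 / m ^ 2)` is a bounded ratio `p / m` times `1 / m`.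
    have l1 : Tendsto (fun k => (p k : ℝ) / m k * (m k : ℝ)⁻¹ * (3 * K8 / s ^ 4)) atTop
        (𝓝 (c * 0 * (3 * K8 / s ^ 4))) :=
      (hr.mul (tendsto_inv_atTop_zero.comp hm)).mul_const _
    have l2 : Tendsto (fun k => K4 * (((p k : ℝ) + 1) ^ (-κ) / tailSum κ (p k) (N k)) *
        ((p k : ℝ) / (m k : ℝ) * (1 - s)⁻¹) ^ 2 / s ^ 2) atTop
        (𝓝 (K4 * 0 * (c * (1 - s)⁻¹) ^ 2 / s ^ 2)) :=
      (((tendsto_max_div_tailSum hκ hα hα1 h hp hN hpN).const_mul K4).mul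
        ((hr.mul_const _).pow 2)).div_const _
    have l3 := (ENNReal.tendsto_ofReal l1).add (ENNReal.tendsto_ofReal l2)
    simp only [mul_zero, zero_mul, zero_div, ENNReal.ofReal_zero, add_zero] at l3
    refine l3.congr fun k => ?_
    congr 1
    rw [← ENNReal.ofReal_natCast (p k), ← ENNReal.ofReal_mul (by positivity)]
    congr 1
    rw [div_mul_eq_mul_div, mul_div_assoc', ← div_div]
    field_simp
  refine tendsto_of_tendsto_of_tendsto_of_le_of_le' tendsto_const_nhds hlim
    (Eventually.of_forall fun _ => zero_le) ?_
  filter_upwards [hup, hlow, hpn, eventually_lt_of_ratio hα1 hN hpN,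
    hN.eventually_gt_atTop 0] with k hku hkl hkpn hkpN hkN
  have hY0 : 0 < (N k : ℝ) ^ (1 - κ) * powerIntegral κ α * (1 + c) :=
    mul_pos (mul_pos (Real.rpow_pos_of_pos (by exact_mod_cast hkN) _) hI) hc1
  refine (measure_mono fun X hX => ?_).trans
    (designLaw_expectedError_deviation_le hκ hkpn.le hkpN (hπ k) hs0 hs1 hs0)
  intro hX'
  obtain ⟨h1, h2⟩ := hX'
  have hX1 : ε₀ * |(asymptoticRisk κ β (N k) α).toReal| <
    |expectedError κ (p k) (π k) X - (asymptoticRisk κ β (N k) α).toReal| := hX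
  rw [hY, abs_of_pos hY0] at hX1
  rw [div_mul_eq_mul_div, div_lt_iff₀ hY0] at hku
  rw [div_mul_eq_mul_div, lt_div_iff₀ hY0] at hkl
  refine absurd hX1 (not_lt.2 (abs_le.2 ⟨?_, ?_⟩)) <;> linarith

/-- The deterministic lower bound by the tail sum diverges after scaling, so each event is
eventually empty. -/
lemma tendstoInfInProb_expectedError {κ : ℝ} (hκ : 1 ≤ κ) (hN : Tendsto N atTop atTop)
    (hpN : Tendsto (fun k => (p k : ℝ) / (N k : ℝ)) atTop (𝓝 0))
    (π : ∀ k, Measure (Fin (N k) → ℝ)) (hπ : ∀ k, IsIsotropic (π k)) :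
    TendstoInfInProb (fun k => designLaw κ (n k) (N k))
      (fun k X => (N k : ℝ) ^ (κ - 1) * expectedError κ (p k) (π k) X) := by
  intro C
  refine tendsto_const_nhds.congr' ?_
  filter_upwards [(tendsto_tailSum_atTop hκ hN hpN).eventually_gt_atTop C] with k hk
  symm
  convert measure_empty (μ := designLaw κ (n k) (N k))
  ext X
  simp only [Set.mem_ofPred_eq, Set.mem_empty_iff_false, iff_false, not_le]
  exact hk.trans_le (mul_le_mul_of_nonneg_left (tailSum_le_expectedError κ (p k) (hπ k) X)
    (by positivity))

end Assembly

end PCR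

theorem theorem1 (κ α β : ℝ) (hκ : 0 < κ) (hα : α ∈ Set.Icc (0 : ℝ) 1)
    (hβ : β ∈ Set.Ioo (0 : ℝ) 1) (hαβ : α < β)
    (p n N : ℕ → ℕ)
    (hp : Tendsto p atTop atTop) (hn : Tendsto n atTop atTop) (hN : Tendsto N atTop atTop)
    (hpN : Tendsto (fun k => (p k : ℝ) / (N k : ℝ)) atTop (𝓝 α))
    (hnN : Tendsto (fun k => (n k : ℝ) / (N k : ℝ)) atTop (𝓝 β))
    (π : ∀ k, Measure (Fin (N k) → ℝ)) (hπ : ∀ k, PCR.IsIsotropic (π k)) :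
    -- convergence in probability when the limiting risk is finite
    ((0 < α ∨ κ < 1) →
      (∀ k, PCR.asymptoticRisk κ β (N k) α ≠ ⊤) ∧
      PCR.TendstoInProb (fun k => PCR.designLaw κ (n k) (N k))
        (fun k X => PCR.expectedError κ (p k) (π k) X)
        (fun k => (PCR.asymptoticRisk κ β (N k) α).toReal)) ∧
    -- the degenerate case, in which the limiting risk is infinite
    ((α = 0 ∧ 1 ≤ κ) →
      (∀ M : ℕ, 0 < M → PCR.asymptoticRisk κ β M α = ⊤) ∧
      PCR.TendstoInfInProb (fun k => PCR.designLaw κ (n k) (N k))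
        (fun k X => (N k : ℝ) ^ (κ - 1) * PCR.expectedError κ (p k) (π k) X)) ∧
    -- the unique root of `h` and the shape of the limiting risk
    ∃ a ∈ Set.Ioo 0 β, PCR.h κ β a = 0 ∧
      (∀ b ∈ Set.Ioo 0 β, PCR.h κ β b = 0 → b = a) ∧
      ∀ M : ℕ, 0 < M →
        StrictAntiOn (PCR.asymptoticRisk κ β M) (Set.Ico 0 a) ∧
        StrictMonoOn (PCR.asymptoticRisk κ β M) (Set.Ioo a β) ∧
        IsLeast (PCR.asymptoticRisk κ β M '' Set.Ico 0 β) (PCR.asymptoticRisk κ β M a) ∧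
        PCR.asymptoticRisk κ β M a = ENNReal.ofReal ((M : ℝ) ^ (1 - κ) * (β / a ^ κ)) := by
  refine ⟨fun h => ⟨fun k => ?_, ?_⟩, ?_, PCR.asymptoticRisk_shape hκ hβ.1 hβ.2⟩
  · rw [PCR.asymptoticRisk_eq_ofReal hκ hβ.2 (N k) hα.1 hαβ h]
    exact ENNReal.ofReal_ne_top
  · exact PCR.tendstoInProb_expectedError hκ hα.1 hβ.2 hαβ h hp hN hpN hnN π hπ
  · rintro ⟨rfl, hκ1⟩
    exact ⟨fun M hM => PCR.asymptoticRisk_zero_eq_top hκ1 hβ.1 hM,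
      PCR.tendstoInfInProb_expectedError hκ1 hN hpN π hπ⟩
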